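/- Let $(\Omega,\mathcal F,\mathbb P)$ be a nonatomic probability space, and identify random variables that are almost surely equal. Let $\mathcal X$ be a rearrangement invariant (r.i.) space over it: a linear subspace $\mathcal X\neq\{0\}$ of $L^0(\Omega,\mathcal F,\mathbb P)$ such that $Y\in\mathcal X$ whenever $|Y|\le|X|$ for some $X\in\mathcal X$, and $Y\in\mathcal X$ whenever $Y$ has the same distribution as some $X\in\mathcal X$, endowed with a complete norm such that $\|X\|\le\|Y\|$ whenever $X,Y\in\mathcal X$ and $|X|\le|Y|$. For $X_n,X\in\mathcal X$ write $X_n\xrightarrow{o}X$ if $X_n\to X$ almost surely and there is $X_0\in\mathcal X$ with $|X_n|\le X_0$ for all $n$. Suppose that the norm of $\mathcal X$ is order continuous, i.e. $\|X_n\|\to0$ whenever $X_n\xrightarrow{o}0$ in $\mathcal X$, and that $\mathcal X\neq L^1$ as sets of random variables. Let $\rho:\mathcal X\to(-\infty,\infty]$ be a functional that is proper (not identically $\infty$), quasiconvex (the set $\{X\in\mathcal X:\rho(X)\le m\}$ is convex for every $m\in\mathbb R$) and law-invariant ($\rho(X)=\rho(Y)$ whenever $X,Y\in\mathcal X$ have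 the same distribution). Then the following are equivalent: 1. $\rho$ has the strong Fatou property: $\rho(X)\le\liminf_n\rho(X_n)$ for all $X_n,X\in\mathcal X$ such that $X_n\to X$ almost surely and $(X_n)$ is norm bounded. 2. $\rho$ is $\sigma(\mathcal X,L^\infty)$ lower semicontinuous: for every $m\in\mathbb R$ the set $\{X\in\mathcal X:\rho(X)\le m\}$ is closed in the coarsest topology on $\mathcal X$ for which $X\mapsto\mathbb E[XZ]$ is continuous for every $Z\in L^\infty$ (every r.i. space is contained in $L^1$, so these expectations are finite). 3. $\rho$ has the Fatou property: $\rho(X)\le\liminf_n\rho(X_n)$ for all $X_n,X\in\mathcal X$ such that $X_n\xrightarrow{o}X$. -/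

import Mathlib

open MeasureTheory ProbabilityTheory Filter Topology
open scoped ENNReal

noncomputable section

/-- A measure is nonatomic if every measurable set of positive measure has a measurable subset of
strictly smaller positive measure. (Mathlib's `NoAtoms` only says that singletons are null.) -/
def IsNonatomic {Ω : Type*} [MeasurableSpace Ω] (P : Measure Ω) : Prop :=
  ∀ A : Set Ω, MeasurableSet A → 0 < P A →
    ∃ B : Set Ω, B ⊆ A ∧ MeasurableSet B ∧ 0 < P B ∧ P B < P A

/-- A Banach function space over `(Ω, P)`: an order ideal of `L⁰(Ω, P)` (random variables modulo
almost sure equality), endowed with a complete norm that is monotone with respect to `|·|`. -/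
structure BanachFunctionSpace {Ω : Type*} [MeasurableSpace Ω] (P : Measure Ω) where
  /-- the underlying linear subspace of `L⁰` -/
  carrier : Submodule ℝ (Ω →ₘ[P] ℝ)
  /-- the subspace is an order ideal -/
  mem_of_abs_le : ∀ X Y : Ω →ₘ[P] ℝ, X ∈ carrier → |Y| ≤ |X| → Y ∈ carrier
  /-- the norm, as a seminorm that separates points (next field) -/
  nrm : Seminorm ℝ carrier
  /-- only the zero vector has norm zero -/
  eq_zero_of_nrm_eq_zero : ∀ X : carrier, nrm X = 0 → X = 0
  /-- the norm is a lattice norm -/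
  nrm_mono : ∀ X Y : carrier,
    |(X : Ω →ₘ[P] ℝ)| ≤ |(Y : Ω →ₘ[P] ℝ)| → nrm X ≤ nrm Y
  /-- the norm is complete: every Cauchy sequence converges -/
  complete : ∀ u : ℕ → carrier,
    (∀ ε : ℝ, 0 < ε → ∃ N : ℕ, ∀ m n : ℕ, N ≤ m → N ≤ n → nrm (u m - u n) < ε) →
    ∃ X : carrier, Tendsto (fun n => nrm (u n - X)) atTop (𝓝 0)

namespace BanachFunctionSpace

variable {Ω : Type*} [MeasurableSpace Ω] {P : Measure Ω}

/-- A rearrangement invariant space: a nonzero Banach function space that contains every random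
variable having the same distribution as one of its members. -/
def IsRearrangementInvariant (E : BanachFunctionSpace P) : Prop :=
  E.carrier ≠ ⊥ ∧
    ∀ X Y : Ω →ₘ[P] ℝ, X ∈ E.carrier → IdentDistrib (⇑Y) (⇑X) P P → Y ∈ E.carrier

/-- Almost sure convergence of a sequence of members of the space to a member. -/
def AsTendsto (E : BanachFunctionSpace P) (X : ℕ → E.carrier) (Y : E.carrier) : Prop :=
  ∀ᵐ ω ∂P, Tendsto (fun n => (X n : Ω →ₘ[P] ℝ) ω) atTop (𝓝 ((Y : Ω →ₘ[P] ℝ) ω))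

/-- Order convergence: almost sure convergence together with domination by a member of the
space. -/
def OrderTendsto (E : BanachFunctionSpace P) (X : ℕ → E.carrier) (Y : E.carrier) : Prop :=
  E.AsTendsto X Y ∧
    ∃ Z : E.carrier, ∀ n : ℕ, |(X n : Ω →ₘ[P] ℝ)| ≤ (Z : Ω →ₘ[P] ℝ)

/-- The norm is order continuous: order null sequences are norm null. -/
def HasOrderContinuousNorm (E : BanachFunctionSpace P) : Prop :=
  ∀ X : ℕ → E.carrier, E.OrderTendsto X 0 → Tendsto (fun n => E.nrm (X n)) atTop (𝓝 0)

/-- The topology `σ(E, L^∞)`: the coarsest topology on `E` for which `X ↦ 𝔼[X Z]` is continuous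
for every `Z ∈ L^∞`. -/
@[reducible] def sigmaLinfty (E : BanachFunctionSpace P) : TopologicalSpace E.carrier :=
  ⨅ Z : Lp ℝ ∞ P, TopologicalSpace.induced
    (fun X : E.carrier => ∫ ω, (X : Ω →ₘ[P] ℝ) ω * Z ω ∂P) inferInstance

/-- A functional with values in `(-∞, ∞]`. -/
def NeverBot (E : BanachFunctionSpace P) (ρ : E.carrier → EReal) : Prop :=
  ∀ X : E.carrier, ρ X ≠ ⊥

/-- `ρ` is proper: not identically `∞`. -/
def IsProper (E : BanachFunctionSpace P) (ρ : E.carrier → EReal) : Prop :=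
  ∃ X : E.carrier, ρ X ≠ ⊤

/-- `ρ` is quasiconvex: its sublevel sets at real levels are convex. -/
def IsQuasiconvex (E : BanachFunctionSpace P) (ρ : E.carrier → EReal) : Prop :=
  ∀ m : ℝ, Convex ℝ {X : E.carrier | ρ X ≤ (m : EReal)}

/-- `ρ` is law-invariant: it takes equal values at members with equal distributions. -/
def IsLawInvariant (E : BanachFunctionSpace P) (ρ : E.carrier → EReal) : Prop :=
  ∀ X Y : E.carrier, IdentDistrib (⇑(X : Ω →ₘ[P] ℝ)) (⇑(Y : Ω →ₘ[P] ℝ)) P P → ρ X = ρ Y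

/-- The Fatou property. -/
def HasFatou (E : BanachFunctionSpace P) (ρ : E.carrier → EReal) : Prop :=
  ∀ (X : ℕ → E.carrier) (Y : E.carrier), E.OrderTendsto X Y →
    ρ Y ≤ liminf (fun n => ρ (X n)) atTop

/-- The strong Fatou property. -/
def HasStrongFatou (E : BanachFunctionSpace P) (ρ : E.carrier → EReal) : Prop :=
  ∀ (X : ℕ → E.carrier) (Y : E.carrier), E.AsTendsto X Y →
    (∃ M : ℝ, ∀ n : ℕ, E.nrm (X n) ≤ M) → ρ Y ≤ liminf (fun n => ρ (X n)) atTop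

/-- `ρ` is `σ(E, L^∞)` lower semicontinuous: its sublevel sets at real levels are
`σ(E, L^∞)`-closed. -/
def IsSigmaLinftyLsc (E : BanachFunctionSpace P) (ρ : E.carrier → EReal) : Prop :=
  ∀ m : ℝ, IsClosed[E.sigmaLinfty] {X : E.carrier | ρ X ≤ (m : EReal)}

end BanachFunctionSpace

end

/-!
The strong Fatou property is formally stronger than the Fatou property, because an order convergent
sequence is norm bounded. The other two implications rest on the following facts about a
rearrangement invariant space `E ≠ L¹` with order continuous norm.

*Tails.* The norm is not assumed to be law-invariant, but it is so up to a constant: if the tails of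
`|g|` are bounded by those of `|f|`, then `‖g‖ ≤ C ‖f‖` (`IsTailConstant`). This is a gliding hump
argument (`IsRearrangementInvariant.exists_normLE_copies`), which needs order continuity,
completeness and the possibility of dominating `|g|` by a copy of a dyadic discretization of `|f|`.
The last point comes from Sierpiński's theorem (`IsNonatomic.exists_measure_eq`).

*Averages of copies.* A nonatomic space carries a uniform random variable, hence random variables of
every law (`IsNonatomic.exists_map_eq`). So each `f` in `E` has copies that are independent
conditionally on a given finite partition. By the strong law of large numbers for their truncations,
and the tail constant for the remainders, the averages of these copies converge in norm to the
conditional expectation of `f` on the partition (`IsTailConstant.exists_average_normLE`). Hence `E`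
embeds into `L¹` and conditioning is bounded in norm.

*From Fatou to lower semicontinuity.* A sublevel set `S` of `ρ` is convex, law-invariant and, by the
Fatou property, norm closed, so it is stable under conditioning on finite partitions. If `X` lies in
the `σ(E, L^∞)` closure of `S`, then for each finite partition the conditional expectation of `X` is
a norm limit of conditional expectations of members of `S`, since only finitely many integrals are
involved. It thus belongs to `S`, and so does `X`, which is a norm limit of such conditional
expectations.

*From lower semicontinuity to strong Fatou.* If the norm balls were not uniformly integrable, then
averaging over small sets would bound the norm of the indicator of `A` by a multiple of `P A`, and
`E` would be `L¹` (`IsTailConstant.exists_forall_eLpNorm_indicator_le`). So by Vitali's theorem norm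
bounded almost surely convergent sequences converge in `L¹`, hence for `σ(E, L^∞)`.
-/

/-! ### Nonatomic probability spaces -/

/-- A family of measurable sets that is totally ordered up to null sets has a least upper bound up
to null sets, whose measure is at most every bound for the measures of the members. -/
lemma MeasureTheory.exists_isLUB_of_ae_chain {Ω : Type*} [MeasurableSpace Ω] (P : Measure Ω)
    [IsFiniteMeasure P] (L : Set (Set Ω)) (hne : L.Nonempty)
    (hmeas : ∀ A ∈ L, MeasurableSet A)
    (hchain : ∀ A ∈ L, ∀ B ∈ L, A ≤ᵐ[P] B ∨ B ≤ᵐ[P] A) :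
    ∃ S : Set Ω, MeasurableSet S ∧ (∀ A ∈ L, A ≤ᵐ[P] S) ∧
      (∀ C : Set Ω, (∀ A ∈ L, A ≤ᵐ[P] C) → S ≤ᵐ[P] C) ∧
      ∀ p : ℝ≥0∞, (∀ A ∈ L, P A ≤ p) → P S ≤ p := by
  obtain ⟨v, -, hv, hvL⟩ := exists_seq_tendsto_sSup (hne.image P) (OrderTop.bddAbove _)
  choose A hAL hAv using hvL
  have hacc : ∀ n, ∃ B ∈ L, Set.accumulate A n ≤ᵐ[P] B := by
    intro n
    induction n with
    | zero => exact ⟨A 0, hAL 0, by simp [Set.accumulate_zero_nat]; exact EventuallyLE.refl _ _⟩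
    | succ n ih =>
      obtain ⟨B, hB, hAB⟩ := ih
      rw [Set.accumulate_succ]
      rcases hchain B hB _ (hAL (n + 1)) with h | h
      · exact ⟨_, hAL (n + 1), by
          simpa using (hAB.trans h).union (EventuallyLE.refl _ (A (n+1)))⟩
      · exact ⟨B, hB, by simpa using hAB.union h⟩
  have hp : ∀ p : ℝ≥0∞, (∀ A ∈ L, P A ≤ p) → P (⋃ n, A n) ≤ p := by
    intro p hp
    rw [measure_iUnion_eq_iSup_accumulate]
    refine iSup_le fun n => ?_
    obtain ⟨B, hB, h⟩ := hacc n
    exact (measure_mono_ae h).trans (hp B hB)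
  have hS : sSup (P '' L) ≤ P (⋃ n, A n) := by
    refine le_of_tendsto' hv fun n => ?_
    rw [← hAv]
    exact measure_mono (Set.subset_iUnion A n)
  have hlub : ∀ C : Set Ω, (∀ n, A n ≤ᵐ[P] C) → (⋃ n, A n) ≤ᵐ[P] C := by
    intro C hC
    have := ae_all_iff.2 hC
    filter_upwards [this] with ω hω h
    obtain ⟨n, hn⟩ := Set.mem_iUnion.1 h
    exact hω n hn
  refine ⟨⋃ n, A n, .iUnion fun n => hmeas _ (hAL n), fun C hC => ?_,
    fun C hC => hlub C fun n => hC _ (hAL n), hp⟩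
  by_cases h : ∃ n, C ≤ᵐ[P] A n
  · obtain ⟨n, hn⟩ := h
    exact hn.trans (Set.subset_iUnion A n).eventuallyLE
  · push Not at h
    refine (ae_eq_of_ae_subset_of_measure_ge (hlub C fun n => ?_) ?_ ?_
      (measure_ne_top _ _)).symm.le
    · exact (hchain C hC _ (hAL n)).resolve_left (h n)
    · exact (le_sSup (Set.mem_image_of_mem P hC)).trans hS
    · exact (MeasurableSet.iUnion fun n => hmeas _ (hAL n)).nullMeasurableSet

/-- A nonatomic probability measure takes every value in `[0, 1]` along a single family of
measurable sets that is totally ordered up to null sets, namely a maximal such family: a value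
missed by it could be filled in by splitting a gap of positive measure. -/
lemma IsNonatomic.exists_ae_chain {Ω : Type*} [MeasurableSpace Ω] {P : Measure Ω}
    [IsProbabilityMeasure P] (hP : IsNonatomic P) :
    ∃ M : Set (Set Ω), (∀ A ∈ M, MeasurableSet A) ∧
      (∀ A ∈ M, ∀ B ∈ M, A ≤ᵐ[P] B ∨ B ≤ᵐ[P] A) ∧ ∀ p ≤ (1 : ℝ≥0∞), ∃ A ∈ M, P A = p := by
  let r : {A : Set Ω // MeasurableSet A} → {A : Set Ω // MeasurableSet A} → Prop :=
    fun A B => (A : Set Ω) ≤ᵐ[P] (B : Set Ω)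
  have hM := maxChain_spec (r := r)
  set M := maxChain r
  have htot : ∀ A ∈ M, ∀ B ∈ M, (A : Set Ω) ≤ᵐ[P] (B : Set Ω) ∨ (B : Set Ω) ≤ᵐ[P] (A : Set Ω) := by
    intro A hA B hB
    by_cases h : A = B
    · subst h; exact Or.inl (EventuallyLE.refl _ _)
    · exact hM.1 hA hB h
  have hins : ∀ A : {A : Set Ω // MeasurableSet A},
      (∀ C ∈ M, (A : Set Ω) ≤ᵐ[P] (C : Set Ω) ∨ (C : Set Ω) ≤ᵐ[P] (A : Set Ω)) → A ∈ M := by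
    intro A hA
    have h : IsChain r (insert A M) := hM.1.insert fun C hC _ => hA C hC
    rw [hM.2 h (Set.subset_insert _ _)]
    exact Set.mem_insert _ _
  have hM0 : (⟨∅, .empty⟩ : {A : Set Ω // MeasurableSet A}) ∈ M :=
    hins _ fun C _ => Or.inl (Set.empty_subset _).eventuallyLE
  have hM1 : (⟨Set.univ, .univ⟩ : {A : Set Ω // MeasurableSet A}) ∈ M :=
    hins _ fun C _ => Or.inr (Set.subset_univ _).eventuallyLE
  refine ⟨Subtype.val '' M, ?_, ?_, ?_⟩
  · rintro _ ⟨A, _, rfl⟩; exact A.2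
  · rintro _ ⟨A, hA, rfl⟩ _ ⟨B, hB, rfl⟩; exact htot A hA B hB
  intro p hp
  by_contra hcon
  have hcon' : ∀ C ∈ M, P (C : Set Ω) ≠ p := fun C hC h => hcon ⟨C, ⟨C, hC, rfl⟩, h⟩
  -- the supremum of the members of measure at most `p`
  obtain ⟨S, hSm, hSub, hSlub, hSp⟩ := exists_isLUB_of_ae_chain P
    (Subtype.val '' {C | C ∈ M ∧ P (C : Set Ω) ≤ p}) ⟨_, _, ⟨hM0, by simp⟩, rfl⟩
    (by rintro _ ⟨A, _, rfl⟩; exact A.2)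
    (by rintro _ ⟨A, hA, rfl⟩ _ ⟨B, hB, rfl⟩; exact htot A hA.1 B hB.1)
  replace hSp := hSp p (by rintro _ ⟨A, hA, rfl⟩; exact hA.2)
  -- the infimum of the members of measure at least `p`, through complements
  obtain ⟨T, hTm, hTub, -, hTp⟩ := exists_isLUB_of_ae_chain P
    ((fun C : {A : Set Ω // MeasurableSet A} => (C : Set Ω)ᶜ) '' {C | C ∈ M ∧ p ≤ P (C : Set Ω)})
    ⟨_, _, ⟨hM1, by simpa using hp⟩, rfl⟩
    (by rintro _ ⟨A, _, rfl⟩; exact A.2.compl)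
    (by
      rintro _ ⟨A, hA, rfl⟩ _ ⟨B, hB, rfl⟩
      rcases htot A hA.1 B hB.1 with h | h
      · exact Or.inr h.compl
      · exact Or.inl h.compl)
  replace hTp := hTp (1 - p) (by
    rintro _ ⟨A, hA, rfl⟩
    simp only [prob_compl_eq_one_sub A.2]
    exact tsub_le_tsub_left hA.2 1)
  have hSM : (⟨S, hSm⟩ : {A : Set Ω // MeasurableSet A}) ∈ M := by
    refine hins _ fun C hC => ?_
    rcases le_total (P (C : Set Ω)) p with h | h
    · exact Or.inr (hSub _ ⟨C, ⟨hC, h⟩, rfl⟩)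
    · refine Or.inl (hSlub _ ?_)
      rintro _ ⟨A, hA, rfl⟩
      rcases htot A hA.1 C hC with h' | h'
      · exact h'
      · exact absurd (le_antisymm hA.2 (h.trans (measure_mono_ae h'))) (hcon' A hA.1)
  have hSlt : P S < p := lt_of_le_of_ne hSp (hcon' _ hSM)
  have hST : ∀ C ∈ M, p ≤ P (C : Set Ω) → S ≤ᵐ[P] (C : Set Ω) := by
    intro C hC h
    rcases htot _ hSM C hC with h' | h'
    · exact h'
    · exact absurd (h.trans (measure_mono_ae h')) (not_le.2 hSlt)
  have hTc : p ≤ P Tᶜ := by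
    rw [prob_compl_eq_one_sub hTm]
    exact ENNReal.le_sub_of_add_le_left
      (ne_top_of_le_ne_top ENNReal.one_ne_top (hTp.trans tsub_le_self))
      ((add_le_add_left hTp _).trans (tsub_add_cancel_of_le hp).le)
  have hcc : ∀ A B : Set Ω, Aᶜ ≤ᵐ[P] B → Bᶜ ≤ᵐ[P] A := by
    intro A B h
    filter_upwards [h] with ω hω hB
    by_contra hA
    exact hB (hω hA)
  have hpos : 0 < P (Tᶜ \ S) := by
    rw [pos_iff_ne_zero]
    intro h
    have : Tᶜ ≤ᵐ[P] S := ae_le_set.2 h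
    exact absurd (hTc.trans (measure_mono_ae this)) (not_le.2 hSlt)
  obtain ⟨D, hD, hDm, hD0, hD1⟩ := hP _ (hTm.compl.diff hSm) hpos
  have hSD : Disjoint S D := Set.disjoint_left.2 fun ω h h' => (hD h').2 h
  have hEM : (⟨S ∪ D, hSm.union hDm⟩ : {A : Set Ω // MeasurableSet A}) ∈ M := by
    refine hins _ fun C hC => ?_
    rcases le_total (P (C : Set Ω)) p with h | h
    · exact Or.inr ((hSub _ ⟨C, ⟨hC, h⟩, rfl⟩).trans Set.subset_union_left.eventuallyLE)
    · left
      have h1 : Tᶜ ≤ᵐ[P] (C : Set Ω) := hcc _ _ (hTub _ ⟨C, ⟨hC, h⟩, rfl⟩)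
      have h2 : D ≤ᵐ[P] (C : Set Ω) := EventuallyLE.trans
        (LE.le.eventuallyLE fun ω h => (hD h).1) h1
      simpa using (hST C hC h).union h2
  have hPE : P (S ∪ D) = P S + P D := measure_union hSD hDm
  rcases le_total (P (S ∪ D)) p with h | h
  · have h1 := measure_mono_ae (hSub _ ⟨_, ⟨hEM, h⟩, rfl⟩)
    simp only [hPE] at h1
    exact absurd h1 (not_le.2 (ENNReal.lt_add_right (measure_ne_top _ _) hD0.ne'))
  · have h1 : (Tᶜ : Set Ω) ≤ᵐ[P] (S ∪ D : Set Ω) := hcc _ _ (hTub _ ⟨_, ⟨hEM, h⟩, rfl⟩)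
    have h2 : (Tᶜ \ S : Set Ω) ≤ᵐ[P] D := by
      filter_upwards [h1] with ω hω h
      exact (hω h.1).resolve_left h.2
    exact absurd (measure_mono_ae h2) (not_le.2 hD1)

/-- A nonatomic probability space carries a random variable that is uniformly distributed on the
unit interval. -/
lemma IsNonatomic.exists_map_eq_volume {Ω : Type*} [MeasurableSpace Ω] {P : Measure Ω}
    [IsProbabilityMeasure P] (hP : IsNonatomic P) :
    ∃ u : Ω → unitInterval, Measurable u ∧ P.map u = volume := by
  classical
  obtain ⟨M, hMm, hMc, hMp⟩ := hP.exists_ae_chain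
  have hq : ∀ q : ℚ, 0 ≤ q → q ≤ 1 → ENNReal.ofReal q ≤ 1 := by
    intro q _ h
    rw [ENNReal.ofReal_le_one]
    exact_mod_cast h
  let Q : Type := {q : ℚ // 0 ≤ q ∧ q ≤ 1}
  choose S hSM hS using fun q : Q => hMp _ (hq q.1 q.2.1 q.2.2)
  let x : Q → unitInterval := fun q => ⟨(q.1 : ℝ), by exact_mod_cast q.2.1, by exact_mod_cast q.2.2⟩
  have hx : ∀ q, ENNReal.ofReal (x q) = P (S q) := fun q => (hS q).symm
  have hnest : ∀ q r : Q, x q < x r → S q ≤ᵐ[P] S r := by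
    intro q r h
    rcases hMc _ (hSM q) _ (hSM r) with h' | h'
    · exact h'
    · have := measure_mono_ae h'
      rw [← hx, ← hx, ENNReal.ofReal_le_ofReal_iff (x q).2.1] at this
      exact absurd this (not_le.2 h)
  let u : Ω → unitInterval := fun ω => ⨅ q : Q, if ω ∈ S q then x q else 1
  have hu : Measurable u := .iInf fun q =>
    Measurable.ite (hMm _ (hSM q)) measurable_const measurable_const
  have hlt : ∀ t : unitInterval, u ⁻¹' Set.Iio t = ⋃ q : {q : Q // x q < t}, S q := by
    intro t
    ext ω
    simp only [Set.mem_preimage, Set.mem_Iio, u, iInf_lt_iff, Set.mem_iUnion]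
    constructor
    · rintro ⟨q, hq⟩
      split_ifs at hq with h
      · exact ⟨⟨q, hq⟩, h⟩
      · exact absurd hq (not_lt.2 t.2.2)
    · rintro ⟨⟨q, hq⟩, h⟩
      exact ⟨q, by rwa [if_pos h]⟩
  have hdense : ∀ a b : ℝ, 0 ≤ a → b ≤ 1 → a < b → ∃ q : Q, a < x q ∧ x q < b := by
    intro a b ha hb hab
    obtain ⟨q, h1, h2⟩ := exists_rat_btwn hab
    exact ⟨⟨q, by exact_mod_cast (ha.trans h1.le), by exact_mod_cast (h2.le.trans hb)⟩, h1, h2⟩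
  have hval : ∀ t : unitInterval, P (u ⁻¹' Set.Iio t) = ENNReal.ofReal t := by
    intro t
    rw [hlt]
    apply le_antisymm
    · refine le_of_forall_gt fun c hc => ?_
      rcases eq_or_lt_of_le t.2.2 with h1 | h1
      · refine lt_of_le_of_lt prob_le_one ?_
        simpa [h1] using hc
      · obtain ⟨r, hr1, hr2⟩ : ∃ r : Q, (t : ℝ) < x r ∧ ENNReal.ofReal (x r) < c := by
          rcases eq_or_ne c ⊤ with rfl | hct
          · obtain ⟨r, hr, -⟩ := hdense t 1 t.2.1 le_rfl h1
            exact ⟨r, hr, ENNReal.ofReal_lt_top⟩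
          · have hc' : (t : ℝ) < c.toReal := (ENNReal.ofReal_lt_iff_lt_toReal t.2.1 hct).1 hc
            obtain ⟨r, hr, hr2⟩ := hdense t (min c.toReal 1) t.2.1 (min_le_right _ _)
              (lt_min hc' h1)
            exact ⟨r, hr, (ENNReal.ofReal_lt_iff_lt_toReal (x r).2.1 hct).2
              (hr2.trans_le (min_le_left _ _))⟩
        refine lt_of_le_of_lt (measure_mono_ae (t := S r) ?_) ((hx r) ▸ hr2)
        have : ∀ᵐ ω ∂P, ∀ q : {q : Q // x q < t}, ω ∈ S q → ω ∈ S r :=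
          ae_all_iff.2 fun q => hnest q r (lt_trans q.2 hr1)
        filter_upwards [this] with ω hω h
        obtain ⟨q, hq⟩ := Set.mem_iUnion.1 h
        exact hω q hq
    · refine le_of_forall_lt fun c hc => ?_
      have hc' : c.toReal < t := (ENNReal.lt_ofReal_iff_toReal_lt (ne_top_of_lt hc)).1 hc
      obtain ⟨r, hr, hr2⟩ := hdense c.toReal t ENNReal.toReal_nonneg t.2.2 hc'
      refine lt_of_lt_of_le ?_ (measure_mono (Set.subset_iUnion
        (fun q : {q : Q // x q < t} => S q.1) ⟨r, hr2⟩))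
      rw [← hx]
      exact (ENNReal.lt_ofReal_iff_toReal_lt (ne_top_of_lt hc)).2 hr
  refine ⟨u, hu, ?_⟩
  have : IsProbabilityMeasure (P.map u) := Measure.isProbabilityMeasure_map hu.aemeasurable
  refine Measure.ext_of_Ici _ _ fun t => ?_
  rw [Measure.map_apply hu measurableSet_Ici, unitInterval.volume_Ici,
    show u ⁻¹' Set.Ici t = (u ⁻¹' Set.Iio t)ᶜ by ext; simp,
    prob_compl_eq_one_sub (hu measurableSet_Iio), hval, ENNReal.ofReal_sub _ t.2.1,
    ENNReal.ofReal_one]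

/-- On a nonatomic probability space every law on a standard Borel space is the law of a random
variable. -/
lemma IsNonatomic.exists_map_eq {Ω : Type*} [MeasurableSpace Ω] {P : Measure Ω}
    [IsProbabilityMeasure P] (hP : IsNonatomic P) {Y : Type*} [MeasurableSpace Y]
    [StandardBorelSpace Y] (μ : Measure Y) [IsProbabilityMeasure μ] :
    ∃ f : Ω → Y, Measurable f ∧ P.map f = μ := by
  have : Nonempty Y := by
    by_contra h
    have := not_nonempty_iff.1 h
    exact IsProbabilityMeasure.ne_zero μ (Measure.eq_zero_of_isEmpty μ)
  obtain ⟨u, hu, hu'⟩ := hP.exists_map_eq_volume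
  obtain ⟨f, hf, hf'⟩ := μ.exists_measurable_map_eq
  exact ⟨f ∘ u, hf.comp hu, by rw [← Measure.map_map hf hu, hu', hf']⟩

/-- **Sierpiński's theorem**: a nonatomic probability measure takes every intermediate value
between two nested sets on a set that lies between them. -/
lemma IsNonatomic.exists_measure_eq {Ω : Type*} [MeasurableSpace Ω] {P : Measure Ω}
    [IsProbabilityMeasure P] (hP : IsNonatomic P) {A B : Set Ω} (hA : MeasurableSet A)
    (hB : MeasurableSet B) (hAB : A ⊆ B) {p : ℝ≥0∞} (hp : P A ≤ p) (hp' : p ≤ P B) :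
    ∃ S, MeasurableSet S ∧ A ⊆ S ∧ S ⊆ B ∧ P S = p := by
  obtain ⟨u, hu, hu'⟩ := hP.exists_map_eq_volume
  let v : Ω → ℝ := fun ω => u ω
  have hv : Measurable v := measurable_subtype_coe.comp hu
  have hvol : ∀ s t : ℝ, P (v ⁻¹' Set.Ico s t) ≤ ENNReal.ofReal (t - s) := by
    intro s t
    have : v ⁻¹' Set.Ico s t = u ⁻¹' (Subtype.val ⁻¹' Set.Ico s t) := rfl
    rw [this, ← Measure.map_apply hu (measurable_subtype_coe measurableSet_Ico), hu',
      unitInterval.volume_apply, ← Real.volume_Ico]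
    exact measure_mono (Set.image_preimage_subset _ _)
  let S : ℝ → Set Ω := fun t => A ∪ (B ∩ v ⁻¹' Set.Iio t)
  have hSm : ∀ t, MeasurableSet (S t) := fun t => hA.union (hB.inter (hv measurableSet_Iio))
  have hmono : Monotone S := fun s t hst => Set.union_subset_union_right _
    (Set.inter_subset_inter_right _ (Set.preimage_mono (Set.Iio_subset_Iio hst)))
  have hlip : LipschitzWith 1 fun t => P.real (S t) := by
    refine LipschitzWith.of_le_add fun s t => ?_
    rcases le_total s t with h | h
    · exact (measureReal_mono (hmono h)).trans (le_add_of_nonneg_right dist_nonneg)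
    · have h1 : S s ⊆ S t ∪ v ⁻¹' Set.Ico t s := by
        rintro ω (h | h)
        · exact Or.inl (Or.inl h)
        · by_cases hh : v ω < t
          · exact Or.inl (Or.inr ⟨h.1, hh⟩)
          · exact Or.inr ⟨not_lt.1 hh, h.2⟩
      have h2 : P.real (v ⁻¹' Set.Ico t s) ≤ dist s t := by
        refine ENNReal.toReal_le_of_le_ofReal dist_nonneg ((hvol t s).trans ?_)
        exact ENNReal.ofReal_le_ofReal (le_abs_self _)
      exact (measureReal_mono h1).trans ((measureReal_union_le _ _).trans (by linarith))
  have h0 : S 0 = A := by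
    ext ω
    simp [S, v, not_lt.2 (u ω).2.1]
  have h2 : S 2 = B := by
    ext ω
    have : v ω < 2 := lt_of_le_of_lt (u ω).2.2 one_lt_two
    simp only [S, Set.mem_union, Set.mem_inter_iff, Set.mem_preimage, Set.mem_Iio, this, and_true]
    exact ⟨fun h => h.elim (fun h => hAB h) id, Or.inr⟩
  have hpt : p ≠ ⊤ := ne_top_of_le_ne_top (measure_ne_top P B) hp'
  have hmem : p.toReal ∈ Set.Icc (P.real (S 0)) (P.real (S 2)) := by
    rw [h0, h2]
    exact ⟨ENNReal.toReal_mono hpt hp, ENNReal.toReal_mono (measure_ne_top _ _) hp'⟩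
  obtain ⟨t, ⟨ht0, ht2⟩, ht⟩ :=
    intermediate_value_Icc (by norm_num : (0 : ℝ) ≤ 2) hlip.continuous.continuousOn hmem
  refine ⟨S t, hSm t, Set.subset_union_left, h2 ▸ hmono ht2, ?_⟩
  exact (ENNReal.toReal_eq_toReal_iff' (measure_ne_top _ _) hpt).1 ht

/-- Conditioning on an event of positive probability preserves nonatomicity. -/
lemma IsNonatomic.cond {Ω : Type*} [MeasurableSpace Ω] {P : Measure Ω} [IsFiniteMeasure P]
    (hP : IsNonatomic P) {A : Set Ω} (hA : MeasurableSet A) (hA0 : P A ≠ 0) :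
    IsNonatomic (P[|A]) := by
  intro B hB hB0
  rw [cond_apply hA] at hB0
  have hpos : 0 < P (A ∩ B) := by
    rw [pos_iff_ne_zero]
    intro h
    simp [h] at hB0
  obtain ⟨D, hD, hDm, hD0, hD1⟩ := hP _ (hA.inter hB) hpos
  have hDA : A ∩ D = D := Set.inter_eq_right.2 fun ω h => (hD h).1
  refine ⟨D, fun ω h => (hD h).2, hDm, ?_, ?_⟩
  · rw [cond_apply hA, hDA]
    exact ENNReal.mul_pos (ENNReal.inv_ne_zero.2 (measure_ne_top _ _)) hD0.ne'
  · rw [cond_apply hA, cond_apply hA, hDA]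
    exact (ENNReal.mul_lt_mul_iff_right (ENNReal.inv_ne_zero.2 (measure_ne_top _ _))
      (ENNReal.inv_ne_top.2 hA0)).2 hD1

/-- On a nonatomic space a property of sets follows by adding sets of measure at most `c` one at a
time, with the number of steps controlled by the measure. -/
lemma IsNonatomic.induction_on_measure_le {Ω : Type*} [MeasurableSpace Ω] {P : Measure Ω}
    [IsProbabilityMeasure P] (hP : IsNonatomic P) {c : ℝ≥0∞} {p : Set Ω → ℕ → Prop}
    (h0 : ∀ B, MeasurableSet B → P B = 0 → p B 0)
    (hadd : ∀ B D m, MeasurableSet B → MeasurableSet D → P D ≤ c → p B m → p (B ∪ D) (m + 1))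
    (m : ℕ) : ∀ B, MeasurableSet B → P B ≤ m * c → p B m := by
  induction m with
  | zero => exact fun B hB h => h0 B hB (by simpa using h)
  | succ m ih =>
    intro B hB h
    obtain ⟨D, hD, -, hDB, hPD⟩ := hP.exists_measure_eq .empty hB (Set.empty_subset _)
      (p := min c (P B)) (by simp) (min_le_right _ _)
    have h1 : P (B \ D) ≤ m * c := by
      rw [measure_sdiff hDB hD.nullMeasurableSet (measure_ne_top _ _), hPD]
      rcases le_total c (P B) with h' | h'
      · rw [min_eq_left h']
        refine tsub_le_iff_right.2 (h.trans (le_of_eq ?_))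
        push_cast
        ring
      · simp [min_eq_right h']
    have := hadd _ D m (hB.diff hD) hD (hPD.le.trans (min_le_left _ _)) (ih _ (hB.diff hD) h1)
    rwa [Set.sdiff_union_of_subset hDB] at this

lemma identDistrib_indicator_one {Ω : Type*} [MeasurableSpace Ω] {P : Measure Ω}
    [IsProbabilityMeasure P] {A B : Set Ω} (hA : MeasurableSet A) (hB : MeasurableSet B)
    (h : P A = P B) :
    IdentDistrib (A.indicator (1 : Ω → ℝ)) (B.indicator (1 : Ω → ℝ)) P P := by
  have hc : P Aᶜ = P Bᶜ := by rw [prob_compl_eq_one_sub hA, prob_compl_eq_one_sub hB, h]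
  have hAm : Measurable (A.indicator (1 : Ω → ℝ)) := measurable_one.indicator hA
  have hBm : Measurable (B.indicator (1 : Ω → ℝ)) := measurable_one.indicator hB
  refine ⟨hAm.aemeasurable, hBm.aemeasurable, Measure.ext fun s hs => ?_⟩
  have e : (1 : Ω → ℝ) = fun _ => 1 := rfl
  classical
  rw [Measure.map_apply hAm hs, Measure.map_apply hBm hs, e,
    Set.indicator_const_preimage_eq_union, Set.indicator_const_preimage_eq_union]
  split_ifs <;> simp [h, hc]

/-! ### Comparison of tails -/

/-- The least `k` with `|x| ≤ 2 ^ k`. -/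
noncomputable def dyadicRank (x : ℝ) : ℕ := Nat.clog 2 ⌈|x|⌉₊

lemma dyadicRank_le_iff {x : ℝ} {k : ℕ} : dyadicRank x ≤ k ↔ |x| ≤ 2 ^ k := by
  rw [dyadicRank, Nat.clog_le_iff_le_pow one_lt_two, Nat.ceil_le]
  norm_cast

lemma lt_dyadicRank_iff {x : ℝ} {k : ℕ} : k < dyadicRank x ↔ 2 ^ k < |x| := by
  rw [← not_le, dyadicRank_le_iff, not_le]

lemma measurable_dyadicRank : Measurable dyadicRank :=
  (measurable_from_top (f := Nat.clog 2)).comp (Nat.measurable_ceil.comp measurable_abs)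

lemma abs_le_two_pow_dyadicRank (x : ℝ) : |x| ≤ 2 ^ dyadicRank x := dyadicRank_le_iff.1 le_rfl

lemma two_pow_dyadicRank_le (x : ℝ) : (2 : ℝ) ^ dyadicRank x ≤ 1 + 2 * |x| := by
  rcases h : dyadicRank x with _ | k
  · simp
  · have : (2 : ℝ) ^ k < |x| := lt_dyadicRank_iff.1 (h ▸ Nat.lt_succ_self k)
    rw [pow_succ]
    linarith

/-- If the tails of `|g|` are bounded by those of `|f|`, then on a nonatomic space some variable
distributed as `dyadicRank ∘ f` dominates `dyadicRank ∘ g`. Its superlevel sets are interpolated one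
after the other by Sierpiński's theorem. -/
lemma IsNonatomic.exists_dyadicRank_le {Ω : Type*} [MeasurableSpace Ω] {P : Measure Ω}
    [IsProbabilityMeasure P] (hP : IsNonatomic P) {f g : Ω → ℝ} (hf : Measurable f)
    (hg : Measurable g)
    (hgf : ∀ t : ℝ, 0 ≤ t → P {ω | t < |g ω|} ≤ P {ω | t < |f ω|}) :
    ∃ J : Ω → ℕ, Measurable J ∧ P.map J = P.map (fun ω => dyadicRank (f ω)) ∧
      ∀ᵐ ω ∂P, dyadicRank (g ω) ≤ J ω := by
  classical
  let A : ℕ → Set Ω := fun k => {ω | k < dyadicRank (g ω)}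
  let F : ℕ → Set Ω := fun k => {ω | k < dyadicRank (f ω)}
  have hAm : ∀ k, MeasurableSet (A k) := fun k =>
    measurableSet_lt measurable_const (measurable_dyadicRank.comp hg)
  have hFm : ∀ k, MeasurableSet (F k) := fun k =>
    measurableSet_lt measurable_const (measurable_dyadicRank.comp hf)
  have hAF : ∀ k, P (A k) ≤ P (F k) := by
    intro k
    simp only [A, F, lt_dyadicRank_iff]
    exact hgf _ (by positivity)
  have hAanti : ∀ k, A (k + 1) ⊆ A k := fun k ω h => lt_trans (Nat.lt_succ_self k) h
  have hFanti : Antitone F := fun k l hkl ω h => lt_of_le_of_lt hkl h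
  let T : ℕ → Type _ := fun k => {S : Set Ω // MeasurableSet S ∧ A k ⊆ S ∧ P S = P (F k)}
  have hstep : ∀ k (S : T k), ∃ S' : T (k + 1), S'.1 ⊆ S.1 := by
    rintro k ⟨S, hS, hAS, hPS⟩
    obtain ⟨S', h1, h2, h3, h4⟩ := hP.exists_measure_eq (hAm (k + 1)) hS
      ((hAanti k).trans hAS) (hAF (k + 1)) (by rw [hPS]; exact measure_mono (hFanti k.le_succ))
    exact ⟨⟨S', h1, h2, h4⟩, h3⟩
  obtain ⟨S0, h1, h2, -, h4⟩ := hP.exists_measure_eq (hAm 0) .univ (Set.subset_univ _) (hAF 0)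
    (measure_mono (Set.subset_univ _))
  choose nxt hnxt using hstep
  let S : ∀ k, T k := fun k => Nat.rec ⟨S0, h1, h2, h4⟩ (fun k S => nxt k S) k
  have hSanti : Antitone fun k => (S k).1 := antitone_nat_of_succ_le fun k => hnxt k (S k)
  have hSm : ∀ k, MeasurableSet (S k).1 := fun k => (S k).2.1
  -- on the null set where all superlevel sets meet, the rank is set to `0`
  let N : Set Ω := ⋂ k, (S k).1
  have hNm : MeasurableSet N := .iInter hSm
  have hN : P N = 0 := by
    have hF0 : ⋂ k, F k = ∅ := by
      ext ω
      simp only [Set.mem_iInter, Set.mem_empty_iff_false, iff_false, not_forall]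
      exact ⟨dyadicRank (f ω), by simp [F]⟩
    have hlim := tendsto_measure_iInter_atTop (μ := P) (fun k => (hFm k).nullMeasurableSet) hFanti
      ⟨0, measure_ne_top _ _⟩
    rw [hF0, measure_empty] at hlim
    refine le_antisymm (ge_of_tendsto' hlim fun k => ?_) bot_le
    exact (measure_mono (Set.iInter_subset _ k)).trans (S k).2.2.2.le
  have hex : ∀ ω, ∃ k, ω ∉ (S k).1 ∨ ω ∈ N := by
    intro ω
    by_cases h : ω ∈ N
    · exact ⟨0, Or.inr h⟩
    · simp only [N, Set.mem_iInter, not_forall] at h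
      exact ⟨h.choose, Or.inl h.choose_spec⟩
  let J : Ω → ℕ := fun ω => Nat.find (hex ω)
  have hJ : Measurable J := measurable_find hex fun k => (hSm k).compl.union hNm
  have hJlt : ∀ k, {ω | k < J ω} = (S k).1 \ N := by
    intro k
    ext ω
    simp only [Set.mem_ofPred_eq, J, Nat.lt_find_iff, not_or, not_not, Set.mem_sdiff]
    exact ⟨fun h => h k le_rfl, fun h l hl => ⟨hSanti hl h.1, h.2⟩⟩
  have hprank : Measurable fun ω => dyadicRank (f ω) := measurable_dyadicRank.comp hf
  refine ⟨J, hJ, ?_, ?_⟩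
  · have : IsProbabilityMeasure (P.map J) := Measure.isProbabilityMeasure_map hJ.aemeasurable
    refine Measure.ext_of_Iic _ _ fun k => ?_
    have e1 : J ⁻¹' Set.Iic k = ((S k).1 \ N)ᶜ := by
      rw [← hJlt]; ext; simp
    have e2 : (fun ω => dyadicRank (f ω)) ⁻¹' Set.Iic k = (F k)ᶜ := by
      ext; simp [F]
    rw [Measure.map_apply hJ measurableSet_Iic, Measure.map_apply hprank measurableSet_Iic, e1, e2,
      prob_compl_eq_one_sub ((hSm k).diff hNm), prob_compl_eq_one_sub (hFm k),
      measure_sdiff_null hN, (S k).2.2.2]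
  · filter_upwards [measure_eq_zero_iff_ae_notMem.1 hN] with ω hω
    by_contra hlt
    rw [not_le] at hlt
    rcases Nat.find_spec (hex ω) with h | h
    · exact h ((S (J ω)).2.2.1 hlt)
    · exact hω h

/-- If the tails of `|g|` are bounded by those of `|f|`, then `|g|` is dominated by a copy of the
discretization of `|f|` to powers of two. -/
lemma IsNonatomic.exists_identDistrib_two_pow {Ω : Type*} [MeasurableSpace Ω] {P : Measure Ω}
    [IsProbabilityMeasure P] (hP : IsNonatomic P) {f g : Ω → ℝ} (hf : Measurable f)
    (hg : Measurable g)
    (hgf : ∀ t : ℝ, 0 ≤ t → P {ω | t < |g ω|} ≤ P {ω | t < |f ω|}) :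
    ∃ h : Ω → ℝ, Measurable h ∧
      IdentDistrib h (fun ω => (2 : ℝ) ^ dyadicRank (f ω)) P P ∧ ∀ᵐ ω ∂P, |g ω| ≤ |h ω| := by
  obtain ⟨J, hJ, hJf, hJg⟩ := hP.exists_dyadicRank_le hf hg hgf
  have hid : IdentDistrib J (fun ω => dyadicRank (f ω)) P P :=
    ⟨hJ.aemeasurable, (measurable_dyadicRank.comp hf).aemeasurable, hJf⟩
  have hpow : Measurable fun n : ℕ => (2 : ℝ) ^ n := measurable_from_top
  refine ⟨fun ω => 2 ^ J ω, hpow.comp hJ, hid.comp hpow, ?_⟩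
  filter_upwards [hJg] with ω hω
  rw [abs_of_pos (by positivity : (0 : ℝ) < 2 ^ J ω)]
  exact (abs_le_two_pow_dyadicRank _).trans (pow_le_pow_right₀ one_le_two hω)

/-! ### Conditional expectations on finite partitions -/

/-- The conditional expectation of `X` given the partition into the fibres of `s`: its value at `ω`
is the mean of `X` over the fibre through `ω`. On null fibres it is `0`. -/
noncomputable def fiberMean {Ω : Type*} [MeasurableSpace Ω] (P : Measure Ω) (s : SimpleFunc Ω ℝ)
    (X : Ω → ℝ) : Ω → ℝ :=
  s.map fun y => ∫ x, X x ∂P[|s ⁻¹' {y}]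

lemma fiberMean_apply {Ω : Type*} [MeasurableSpace Ω] (P : Measure Ω) (s : SimpleFunc Ω ℝ)
    (X : Ω → ℝ) (ω : Ω) :
    fiberMean P s X ω = (P.real (s ⁻¹' {s ω}))⁻¹ * ∫ x in s ⁻¹' {s ω}, X x ∂P := by
  simp [fiberMean, ProbabilityTheory.cond, integral_smul_measure, Measure.real]

lemma measurable_fiberMean {Ω : Type*} [MeasurableSpace Ω] (P : Measure Ω) (s : SimpleFunc Ω ℝ)
    (X : Ω → ℝ) : Measurable (fiberMean P s X) := (s.map _).measurable

/-- On a nonatomic space every random variable `X` has, given a finite partition, conditionally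
independent copies. By the law of large numbers their averages tend to the conditional
expectation, and this holds for all bounded functions of the copies. -/
lemma IsNonatomic.exists_copies {Ω : Type*} [MeasurableSpace Ω] {P : Measure Ω}
    [IsProbabilityMeasure P] (hP : IsNonatomic P) {X : Ω → ℝ} (hX : Measurable X)
    (s : SimpleFunc Ω ℝ) :
    ∃ Y : ℕ → Ω → ℝ, (∀ i, Measurable (Y i)) ∧ (∀ i, IdentDistrib (Y i) X P P) ∧
      ∀ g : ℝ → ℝ, Measurable g → (∃ K, ∀ x, |g x| ≤ K) → ∀ᵐ ω ∂P,
        Tendsto (fun n : ℕ => (∑ i ∈ Finset.range n, g (Y i ω)) / n) atTop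
          (𝓝 (fiberMean P s (fun x => g (X x)) ω)) := by
  classical
  have hG : ∀ y : ℝ, ∃ G : Ω → ℕ → ℝ, Measurable G ∧ (P (s ⁻¹' {y}) ≠ 0 →
      (P[|s ⁻¹' {y}]).map G = Measure.infinitePi fun _ : ℕ => (P[|s ⁻¹' {y}]).map X) := by
    intro y
    by_cases h : P (s ⁻¹' {y}) = 0
    · exact ⟨fun _ _ => 0, measurable_const, fun h' => absurd h h'⟩
    · have := cond_isProbabilityMeasure h
      have : IsProbabilityMeasure ((P[|s ⁻¹' {y}]).map X) :=
        Measure.isProbabilityMeasure_map hX.aemeasurable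
      obtain ⟨G, h1, h2⟩ := (hP.cond (s.measurableSet_fiber y) h).exists_map_eq
        (Measure.infinitePi fun _ : ℕ => (P[|s ⁻¹' {y}]).map X)
      exact ⟨G, h1, fun _ => h2⟩
  choose G hGm hG using hG
  have hGi : ∀ y i, P (s ⁻¹' {y}) ≠ 0 →
      (P[|s ⁻¹' {y}]).map (fun ω => G y ω i) = (P[|s ⁻¹' {y}]).map X := by
    intro y i h
    have := cond_isProbabilityMeasure h
    have : IsProbabilityMeasure ((P[|s ⁻¹' {y}]).map X) :=
      Measure.isProbabilityMeasure_map hX.aemeasurable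
    rw [← Measure.infinitePi_map_eval (fun _ : ℕ => (P[|s ⁻¹' {y}]).map X) i, ← hG y h,
      Measure.map_map (measurable_pi_apply i) (hGm y)]
    rfl
  have hYm : ∀ i, Measurable fun ω => G (s ω) ω i := fun i =>
    s.measurable_bind (fun y ω => G y ω i) fun y => (measurable_pi_apply i).comp (hGm y)
  have htot : ∀ B : Set Ω, P B = ∑ y ∈ s.range, P (s ⁻¹' {y} ∩ B) := by
    intro B
    have := sum_measure_preimage_singleton (μ := P.restrict B) s.range (f := s)
      fun y _ => s.measurableSet_fiber y
    simp only [Measure.restrict_apply (s.measurableSet_fiber _)] at this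
    rw [this, show s ⁻¹' (s.range : Set ℝ) = Set.univ from
      Set.eq_univ_of_forall fun ω => s.mem_range_self ω, Measure.restrict_apply_univ]
  refine ⟨fun i ω => G (s ω) ω i, hYm, fun i => ⟨(hYm i).aemeasurable, hX.aemeasurable, ?_⟩, ?_⟩
  · ext B hB
    rw [Measure.map_apply (hYm i) hB, Measure.map_apply hX hB, htot, htot (X ⁻¹' B)]
    refine Finset.sum_congr rfl fun y _ => ?_
    by_cases h : P (s ⁻¹' {y}) = 0
    · rw [measure_inter_null_of_null_left _ h, measure_inter_null_of_null_left _ h]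
    · have e : s ⁻¹' {y} ∩ (fun ω => G (s ω) ω i) ⁻¹' B
          = s ⁻¹' {y} ∩ (fun ω => G y ω i) ⁻¹' B := by
        ext ω
        simp only [Set.mem_inter_iff, Set.mem_preimage, Set.mem_singleton_iff]
        exact and_congr_right fun h => by rw [h]
      have hGm' : Measurable fun ω => G y ω i := (measurable_pi_apply i).comp (hGm y)
      have := congrArg (fun μ => μ B) (hGi y i h)
      simp only [Measure.map_apply hGm' hB, Measure.map_apply hX hB] at this
      rw [e, ← cond_mul_eq_inter (s.measurableSet_fiber y) _ P, this,
        cond_mul_eq_inter (s.measurableSet_fiber y)]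
  · rintro g hg ⟨K, hK⟩
    have hfib : ∀ y ∈ s.range, ∀ᵐ ω ∂P, s ω = y →
        Tendsto (fun n : ℕ => (∑ i ∈ Finset.range n, g (G y ω i)) / n) atTop
          (𝓝 (∫ x, g (X x) ∂P[|s ⁻¹' {y}])) := by
      intro y _
      by_cases h : P (s ⁻¹' {y}) = 0
      · filter_upwards [measure_eq_zero_iff_ae_notMem.1 h] with ω hω h'
        exact absurd h' hω
      have := cond_isProbabilityMeasure h
      have : IsProbabilityMeasure ((P[|s ⁻¹' {y}]).map X) :=
        Measure.isProbabilityMeasure_map hX.aemeasurable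
      have hgG : ∀ i, Measurable fun ω => g (G y ω i) := fun i =>
        hg.comp ((measurable_pi_apply i).comp (hGm y))
      have hid : ∀ i, IdentDistrib (fun ω => G y ω i) X (P[|s ⁻¹' {y}]) (P[|s ⁻¹' {y}]) :=
        fun i => ⟨((measurable_pi_apply i).comp (hGm y)).aemeasurable, hX.aemeasurable, hGi y i h⟩
      have hind : iIndepFun (fun i ω => g (G y ω i)) (P[|s ⁻¹' {y}]) := by
        have h1 : iIndepFun (fun i ω => G y ω i) (P[|s ⁻¹' {y}]) := by
          have hm : ∀ i, Measurable fun ω => G y ω i :=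
            fun i => (measurable_pi_apply i).comp (hGm y)
          rw [iIndepFun_iff_map_fun_eq_infinitePi_map hm]
          simp_rw [hGi y _ h]
          exact hG y h
        exact h1.comp (fun _ => g) fun _ => hg
      have hslln := strong_law_ae_real (μ := P[|s ⁻¹' {y}]) (fun i ω => g (G y ω i))
        (Integrable.of_bound (hgG 0).aestronglyMeasurable K (ae_of_all _ fun ω => hK _))
        (fun i j hij => hind.indepFun hij)
        (fun i => ((hid i).trans (hid 0).symm).comp hg)
      have hmean : ∫ x, g (G y x 0) ∂(P[|s ⁻¹' {y}]) = ∫ x, g (X x) ∂(P[|s ⁻¹' {y}]) :=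
        ((hid 0).comp hg).integral_eq
      rw [hmean] at hslln
      rw [ProbabilityTheory.cond, Measure.ae_ennreal_smul_measure_iff
        (ENNReal.inv_ne_zero.2 (measure_ne_top _ _))] at hslln
      exact (ae_restrict_iff' (s.measurableSet_fiber y)).1 hslln
    filter_upwards [(Finset.eventually_all s.range).2 hfib] with ω hω
    exact hω (s ω) (s.mem_range_self ω) rfl

/-- Uniform bound for fibre means in terms of integrals over the fibres. -/
lemma exists_abs_fiberMean_le {Ω : Type*} [MeasurableSpace Ω] (P : Measure Ω)
    (s : SimpleFunc Ω ℝ) : ∃ R : ℝ, 0 < R ∧ ∀ (f : Ω → ℝ) (δ : ℝ),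
      (∀ y ∈ s.range, |∫ x in s ⁻¹' {y}, f x ∂P| ≤ δ) → ∀ ω, |fiberMean P s f ω| ≤ R * δ := by
  refine ⟨1 + ∑ y ∈ s.range, (P.real (s ⁻¹' {y}))⁻¹, ?_, fun f δ h ω => ?_⟩
  · have : 0 ≤ ∑ y ∈ s.range, (P.real (s ⁻¹' {y}))⁻¹ := Finset.sum_nonneg fun y _ => by positivity
    linarith
  · rw [fiberMean_apply, abs_mul, abs_of_nonneg (by positivity)]
    have hδ := h (s ω) (s.mem_range_self ω)
    refine mul_le_mul ?_ hδ (abs_nonneg _) ?_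
    · have := Finset.single_le_sum (f := fun y => (P.real (s ⁻¹' {y}))⁻¹)
        (fun y _ => by positivity) (s.mem_range_self ω)
      linarith
    · have : 0 ≤ ∑ y ∈ s.range, (P.real (s ⁻¹' {y}))⁻¹ :=
        Finset.sum_nonneg fun y _ => by positivity
      linarith

lemma fiberMean_sub {Ω : Type*} [MeasurableSpace Ω] {P : Measure Ω} (s : SimpleFunc Ω ℝ)
    {f g : Ω → ℝ} (hf : Integrable f P) (hg : Integrable g P) :
    fiberMean P s (f - g) = fiberMean P s f - fiberMean P s g := by
  ext ω
  simp only [Pi.sub_apply, fiberMean_apply]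
  rw [integral_sub hf.integrableOn hg.integrableOn, mul_sub]

lemma fiberMean_self {Ω : Type*} [MeasurableSpace Ω] {P : Measure Ω} [IsFiniteMeasure P]
    (s : SimpleFunc Ω ℝ) : fiberMean P s s =ᵐ[P] s := by
  have h : ∀ᵐ ω ∂P, ∀ y ∈ s.range, P (s ⁻¹' {y}) = 0 → s ω ≠ y := by
    refine (Finset.eventually_all s.range).2 fun y _ => ?_
    by_cases h : P (s ⁻¹' {y}) = 0
    · filter_upwards [measure_eq_zero_iff_ae_notMem.1 h] with ω hω _ using hω
    · exact ae_of_all _ fun ω h' => absurd h' h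
  filter_upwards [h] with ω hω
  have h0 : P.real (s ⁻¹' {s ω}) ≠ 0 := fun h' =>
    hω (s ω) (s.mem_range_self ω) ((measureReal_eq_zero_iff).1 h') rfl
  have h1 : ∫ x in s ⁻¹' {s ω}, s x ∂P = P.real (s ⁻¹' {s ω}) * s ω := by
    rw [setIntegral_congr_fun (g := fun _ => s ω) (s.measurableSet_fiber _) fun x hx => hx,
      setIntegral_const, smul_eq_mul]
  rw [fiberMean_apply, h1, inv_mul_cancel_left₀ h0]

/-! ### Truncation -/

/-- Truncation at the levels `-K` and `K`. -/
noncomputable def clamp (K x : ℝ) : ℝ := max (-K) (min x K)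

lemma measurable_clamp (K : ℝ) : Measurable (clamp K) :=
  measurable_const.max (measurable_id.min measurable_const)

lemma abs_clamp_le {K : ℝ} (hK : 0 ≤ K) (x : ℝ) : |clamp K x| ≤ K :=
  abs_le.2 ⟨le_max_left _ _, max_le (by linarith) (min_le_right _ _)⟩

lemma clamp_eq_self {K x : ℝ} (h : |x| ≤ K) : clamp K x = x := by
  rw [clamp, min_eq_left (abs_le.1 h).2, max_eq_right (abs_le.1 h).1]

lemma abs_clamp_le_abs {K : ℝ} (hK : 0 ≤ K) (x : ℝ) : |clamp K x| ≤ |x| := by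
  by_cases h : |x| ≤ K
  · rw [clamp_eq_self h]
  · exact (abs_clamp_le hK x).trans (not_le.1 h).le

/-! ### Functions representing members of a Banach function space -/

namespace BanachFunctionSpace

variable {Ω : Type*} [MeasurableSpace Ω] {P : Measure Ω} {E : BanachFunctionSpace P}

/-- `E.NormLE f c` says that the function `f` represents a member of `E` whose norm is at most
`c`. -/
def NormLE (E : BanachFunctionSpace P) (f : Ω → ℝ) (c : ℝ) : Prop :=
  ∃ X : E.carrier, (X : Ω →ₘ[P] ℝ) =ᵐ[P] f ∧ E.nrm X ≤ c

lemma normLE_coe (X : E.carrier) : E.NormLE (X : Ω →ₘ[P] ℝ) (E.nrm X) := ⟨X, ae_eq_rfl, le_rfl⟩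

lemma normLE_coe_iff {X : E.carrier} {c : ℝ} : E.NormLE (X : Ω →ₘ[P] ℝ) c ↔ E.nrm X ≤ c := by
  refine ⟨fun ⟨Y, hY, hc⟩ => ?_, fun h => ⟨X, ae_eq_rfl, h⟩⟩
  have : Y = X := Subtype.ext (AEEqFun.ext hY)
  rwa [← this]

lemma coe_sub_ae_eq (X Y : E.carrier) :
    ((X - Y : E.carrier) : Ω →ₘ[P] ℝ) =ᵐ[P]
      (X : Ω →ₘ[P] ℝ) - ((Y : Ω →ₘ[P] ℝ) : Ω → ℝ) :=
  AEEqFun.coeFn_sub _ _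

namespace NormLE

variable {f g : Ω → ℝ} {c d : ℝ}

lemma congr (hf : E.NormLE f c) (h : f =ᵐ[P] g) : E.NormLE g c := by
  obtain ⟨X, hX, hc⟩ := hf
  exact ⟨X, hX.trans h, hc⟩

lemma weaken (hf : E.NormLE f c) (h : c ≤ d) : E.NormLE f d := by
  obtain ⟨X, hX, hc⟩ := hf
  exact ⟨X, hX, hc.trans h⟩

lemma nonneg (hf : E.NormLE f c) : 0 ≤ c := by
  obtain ⟨X, -, hc⟩ := hf
  exact (apply_nonneg _ _).trans hc

lemma aestronglyMeasurable (hf : E.NormLE f c) : AEStronglyMeasurable f P := by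
  obtain ⟨X, hX, -⟩ := hf
  exact X.1.aestronglyMeasurable.congr hX

lemma zero : E.NormLE (0 : Ω → ℝ) 0 :=
  ⟨0, AEEqFun.coeFn_zero, (map_zero E.nrm).le⟩

lemma add (hf : E.NormLE f c) (hg : E.NormLE g d) : E.NormLE (f + g) (c + d) := by
  obtain ⟨X, hX, hc⟩ := hf
  obtain ⟨Y, hY, hd⟩ := hg
  exact ⟨X + Y, (AEEqFun.coeFn_add _ _).trans (hX.add hY),
    (map_add_le_add _ _ _).trans (add_le_add hc hd)⟩

lemma smul (a : ℝ) (hf : E.NormLE f c) : E.NormLE (a • f) (|a| * c) := by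
  obtain ⟨X, hX, hc⟩ := hf
  refine ⟨a • X, (AEEqFun.coeFn_smul _ _).trans (hX.const_smul a), ?_⟩
  rw [map_smul_eq_mul, Real.norm_eq_abs]
  gcongr

lemma neg (hf : E.NormLE f c) : E.NormLE (-f) c := by
  simpa using hf.smul (-1)

lemma sub (hf : E.NormLE f c) (hg : E.NormLE g d) : E.NormLE (f - g) (c + d) := by
  rw [sub_eq_add_neg]
  exact hf.add hg.neg

lemma sum {ι : Type*} {s : Finset ι} {f : ι → Ω → ℝ} {c : ι → ℝ}
    (hf : ∀ i ∈ s, E.NormLE (f i) (c i)) : E.NormLE (∑ i ∈ s, f i) (∑ i ∈ s, c i) := by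
  classical
  induction s using Finset.induction_on with
  | empty => simpa using zero
  | insert a s ha ih =>
    rw [Finset.sum_insert ha, Finset.sum_insert ha]
    exact (hf a (s.mem_insert_self a)).add (ih fun i hi => hf i (Finset.mem_insert_of_mem hi))

/-- The ideal property together with monotonicity of the norm. -/
lemma mono (hf : E.NormLE f c) (hg : AEStronglyMeasurable g P)
    (h : ∀ᵐ ω ∂P, |g ω| ≤ |f ω|) : E.NormLE g c := by
  obtain ⟨X, hX, hc⟩ := hf
  have hle : |AEEqFun.mk g hg| ≤ |(X : Ω →ₘ[P] ℝ)| := by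
    rw [← AEEqFun.coeFn_le]
    filter_upwards [AEEqFun.coeFn_abs (AEEqFun.mk g hg), AEEqFun.coeFn_abs (X : Ω →ₘ[P] ℝ),
      AEEqFun.coeFn_mk g hg, hX, h] with ω h1 h2 h3 h4 h5
    rw [h1, h2, h3, h4]
    exact h5
  let Y : E.carrier := ⟨AEEqFun.mk g hg, E.mem_of_abs_le X _ X.2 hle⟩
  exact ⟨Y, AEEqFun.coeFn_mk g hg, (E.nrm_mono Y X hle).trans hc⟩

lemma abs (hf : E.NormLE f c) : E.NormLE (fun ω => |f ω|) c :=
  hf.mono (continuous_abs.comp_aestronglyMeasurable hf.aestronglyMeasurable)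
    (ae_of_all _ fun _ => (abs_abs _).le)

lemma of_forall_pos (hf : ∀ ε > 0, E.NormLE f (c + ε)) : E.NormLE f c := by
  obtain ⟨X, hX, -⟩ := hf 1 one_pos
  refine ⟨X, hX, le_of_forall_pos_le_add fun ε hε => ?_⟩
  exact normLE_coe_iff.1 ((hf ε hε).congr hX.symm)

lemma ae_eq_zero (hf : E.NormLE f 0) : f =ᵐ[P] 0 := by
  obtain ⟨X, hX, hc⟩ := hf
  have : X = 0 := E.eq_zero_of_nrm_eq_zero X (le_antisymm hc (apply_nonneg _ _))
  rw [this] at hX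
  exact hX.symm.trans AEEqFun.coeFn_zero

end NormLE

lemma normLE_mk_iff_mem {f : Ω → ℝ} (hf : AEStronglyMeasurable f P) :
    (∃ c, E.NormLE f c) ↔ AEEqFun.mk f hf ∈ E.carrier := by
  constructor
  · rintro ⟨c, X, hX, -⟩
    have : AEEqFun.mk f hf = X := AEEqFun.ext ((AEEqFun.coeFn_mk f hf).trans hX.symm)
    rw [this]
    exact X.2
  · intro h
    exact ⟨_, ⟨_, h⟩, AEEqFun.coeFn_mk f hf, le_rfl⟩

/-- Completeness of the norm for sequences of functions. -/
lemma exists_normLE_limit {f : ℕ → Ω → ℝ} (hf : ∀ n, ∃ c, E.NormLE (f n) c)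
    (hcau : ∀ ε > 0, ∃ N, ∀ m n, N ≤ m → N ≤ n → E.NormLE (f m - f n) ε) :
    ∃ g c, E.NormLE g c ∧ ∀ ε > 0, ∃ N, ∀ n, N ≤ n → E.NormLE (f n - g) ε := by
  choose c u hu _ using hf
  have hsub : ∀ (m n : ℕ) (ε : ℝ), E.NormLE (f m - f n) ε → E.nrm (u m - u n) ≤ ε := by
    intro m n ε h
    exact normLE_coe_iff.1 (h.congr ((coe_sub_ae_eq _ _).trans ((hu m).sub (hu n))).symm)
  obtain ⟨X, hX⟩ := E.complete u fun ε hε => by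
    obtain ⟨N, hN⟩ := hcau (ε / 2) (half_pos hε)
    exact ⟨N, fun m n hm hn => (hsub m n _ (hN m n hm hn)).trans_lt (half_lt_self hε)⟩
  refine ⟨_, _, normLE_coe X, fun ε hε => ?_⟩
  obtain ⟨N, hN⟩ := eventually_atTop.1 (hX.eventually (gt_mem_nhds hε))
  exact ⟨N, fun n hn => ⟨u n - X, (coe_sub_ae_eq _ _).trans ((hu n).sub ae_eq_rfl), (hN n hn).le⟩⟩

/-- An absolutely convergent series in `E` has all its partial sums dominated by one member. -/
lemma exists_normLE_sum_abs_le {u : ℕ → Ω → ℝ} (hu : ∀ n, E.NormLE (u n) ((1 / 2) ^ n)) :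
    ∃ Z c, E.NormLE Z c ∧ ∀ᵐ ω ∂P, ∀ n, ∑ k ∈ Finset.range n, |u k ω| ≤ Z ω := by
  let S : ℕ → Ω → ℝ := fun n => ∑ k ∈ Finset.range n, fun ω => |u k ω|
  have hSub : ∀ n m, n ≤ m → E.NormLE (S m - S n) (2 * (1 / 2) ^ n) := by
    intro n m hnm
    have h1 : S m - S n = ∑ k ∈ Finset.Ico n m, fun ω => |u k ω| :=
      (Finset.sum_Ico_eq_sub _ hnm).symm
    rw [h1]
    refine (NormLE.sum fun k _ => (hu k).abs).weaken ?_
    rw [geom_sum_Ico (by norm_num) hnm]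
    have h2 : (0 : ℝ) ≤ (1 / 2) ^ m := by positivity
    have h3 : ((1 / 2 : ℝ) ^ m - (1 / 2) ^ n) / (1 / 2 - 1) =
        2 * (1 / 2) ^ n - 2 * (1 / 2) ^ m := by
      ring
    linarith
  obtain ⟨Z, c, hZ, hlim⟩ := exists_normLE_limit (E := E) (f := S)
    (fun n => ⟨_, NormLE.sum fun k _ => (hu k).abs⟩) fun ε hε => by
      obtain ⟨N, hN⟩ := exists_pow_lt_of_lt_one (half_pos hε) (by norm_num : (1 / 2 : ℝ) < 1)
      have hpow : ∀ n, N ≤ n → 2 * (1 / 2 : ℝ) ^ n ≤ ε := by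
        intro n hn
        have := pow_le_pow_of_le_one (by norm_num : (0 : ℝ) ≤ 1 / 2) (by norm_num) hn
        linarith
      refine ⟨N, fun m n hm hn => ?_⟩
      rcases le_total n m with h | h
      · exact (hSub n m h).weaken (hpow n hn)
      · have := (hSub m n h).neg.weaken (hpow m hm)
        rwa [neg_sub] at this
  refine ⟨Z, c, hZ, ae_all_iff.2 fun N => ?_⟩
  have hSm : ∀ n, AEStronglyMeasurable (S n) P := fun n =>
    (NormLE.sum fun k _ => (hu k).abs).aestronglyMeasurable
  -- the positive part of `S N - Z` has norm zero
  have hpos : E.NormLE (fun ω => max ((S N - Z) ω) 0) 0 := by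
    refine NormLE.of_forall_pos fun ε hε => ?_
    obtain ⟨M, hM⟩ := hlim ε hε
    rw [zero_add]
    refine (hM (max M N) (le_max_left _ _)).mono
      (((hSm N).sub hZ.aestronglyMeasurable).sup aestronglyMeasurable_const)
      (ae_of_all _ fun ω => ?_)
    rw [abs_of_nonneg (le_max_right _ _)]
    refine max_le ?_ (abs_nonneg _)
    refine le_trans ?_ (le_abs_self _)
    simp only [Pi.sub_apply, S, Finset.sum_apply]
    refine sub_le_sub_right ?_ _
    exact Finset.sum_le_sum_of_subset_of_nonneg
      (Finset.range_mono (le_max_right _ _)) fun _ _ _ => abs_nonneg _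
  filter_upwards [hpos.ae_eq_zero] with ω hω
  have h1 : (S N - Z) ω ≤ 0 := (le_max_left _ _).trans hω.le
  simp only [Pi.sub_apply, S, Finset.sum_apply] at h1
  linarith

/-- Order continuity of the norm for sequences of functions. -/
lemma HasOrderContinuousNorm.eventually_normLE (hoc : E.HasOrderContinuousNorm)
    {f : ℕ → Ω → ℝ} {Z : Ω → ℝ} {c : ℝ} (hf : ∀ n, AEStronglyMeasurable (f n) P)
    (hZ : E.NormLE Z c) (hle : ∀ n, ∀ᵐ ω ∂P, |f n ω| ≤ |Z ω|)
    (hlim : ∀ᵐ ω ∂P, Tendsto (fun n => f n ω) atTop (𝓝 0)) {ε : ℝ} (hε : 0 < ε) :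
    ∀ᶠ n in atTop, E.NormLE (f n) ε := by
  choose u hu _ using fun n => hZ.mono (hf n) (hle n)
  obtain ⟨W, hW, -⟩ := hZ.abs
  have hord : E.OrderTendsto u 0 := by
    refine ⟨?_, W, fun n => ?_⟩
    · filter_upwards [hlim, ae_all_iff.2 hu, AEEqFun.coeFn_zero (μ := P) (α := Ω) (β := ℝ)]
        with ω h1 h2 h3
      simp only [h2, ZeroMemClass.coe_zero]
      rw [h3]
      exact h1
    · rw [← AEEqFun.coeFn_le]
      filter_upwards [AEEqFun.coeFn_abs (u n : Ω →ₘ[P] ℝ), hu n, hW, hle n] with ω h1 h2 h3 h4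
      rw [h1, h2, h3]
      exact h4
  filter_upwards [(hoc u hord).eventually (gt_mem_nhds hε)] with n hn
  exact ⟨u n, hu n, hn.le⟩

lemma IsRearrangementInvariant.normLE_of_identDistrib (hri : E.IsRearrangementInvariant)
    {f g : Ω → ℝ} {c : ℝ} (hf : E.NormLE f c) (h : IdentDistrib g f P P) :
    ∃ d, E.NormLE g d := by
  obtain ⟨X, hX, -⟩ := hf
  have hg : AEStronglyMeasurable g P := h.aemeasurable_fst.aestronglyMeasurable
  rw [normLE_mk_iff_mem hg]
  refine hri.2 X _ X.2 ?_
  have h1 : IdentDistrib (AEEqFun.mk g hg) g P P :=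
    .of_ae_eq (AEEqFun.mk g hg).aestronglyMeasurable.aemeasurable (AEEqFun.coeFn_mk g hg)
  have h2 : IdentDistrib (X : Ω →ₘ[P] ℝ) f P P :=
    .of_ae_eq X.1.aestronglyMeasurable.aemeasurable hX
  exact (h1.trans h).trans h2.symm

/-! ### The tail constant of a rearrangement invariant space -/

/-- A rearrangement invariant space over a nonatomic space contains the constants: it contains the
indicator of a set of positive measure, hence those of all smaller sets, and finitely many of these
cover the whole space. -/
lemma IsRearrangementInvariant.exists_normLE_one [IsProbabilityMeasure P] (hP : IsNonatomic P)
    (hri : E.IsRearrangementInvariant) : ∃ c, E.NormLE 1 c := by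
  obtain ⟨X, hX, hX0⟩ := Submodule.exists_mem_ne_zero_of_ne_bot hri.1
  have hXm : Measurable X := X.measurable
  obtain ⟨n, hn⟩ : ∃ n : ℕ, P {ω | ((n : ℝ) + 1)⁻¹ < |X ω|} ≠ 0 := by
    by_contra! h
    refine hX0 (AEEqFun.ext ?_)
    have h' : ∀ᵐ ω ∂P, ∀ n : ℕ, ¬ ((n : ℝ) + 1)⁻¹ < |X ω| :=
      ae_all_iff.2 fun n => measure_eq_zero_iff_ae_notMem.1 (h n)
    filter_upwards [h', AEEqFun.coeFn_zero (μ := P) (α := Ω) (β := ℝ)] with ω h1 h2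
    rw [h2]
    by_contra h3
    obtain ⟨n, hn⟩ := exists_nat_one_div_lt (abs_pos.2 h3)
    exact h1 n (by simpa using hn)
  set A := {ω | ((n : ℝ) + 1)⁻¹ < |X ω|} with hA
  have hAm : MeasurableSet A := measurableSet_lt measurable_const hXm.abs
  have hXE : E.NormLE X (E.nrm ⟨X, hX⟩) := normLE_coe (E := E) ⟨X, hX⟩
  obtain ⟨d, hAE⟩ : ∃ d, E.NormLE (A.indicator 1) d := by
    refine ⟨_, (hXE.smul ((n : ℝ) + 1)).mono
      (measurable_one.indicator hAm).aestronglyMeasurable (ae_of_all _ fun ω => ?_)⟩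
    by_cases h : ω ∈ A
    · rw [Set.indicator_of_mem h, Pi.smul_apply, smul_eq_mul, abs_mul,
        abs_of_pos (by positivity : (0 : ℝ) < n + 1), Pi.one_apply, abs_one]
      have h' : ((n : ℝ) + 1)⁻¹ < |X ω| := h
      rw [inv_lt_iff_one_lt_mul₀' (by positivity)] at h'
      exact h'.le
    · rw [Set.indicator_of_notMem h, abs_zero]
      exact abs_nonneg _
  have hsmall : ∀ D, MeasurableSet D → P D ≤ P A → ∃ d, E.NormLE (D.indicator 1) d := by
    intro D hD h
    obtain ⟨A', hA', -, hAA, hPA⟩ :=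
      hP.exists_measure_eq .empty hAm (Set.empty_subset _) (p := P D) (by simp) h
    refine hri.normLE_of_identDistrib (f := A'.indicator 1) (c := d) ?_
      (identDistrib_indicator_one hD hA' hPA.symm)
    refine hAE.mono (measurable_one.indicator hA').aestronglyMeasurable (ae_of_all _ fun ω => ?_)
    by_cases h' : ω ∈ A'
    · rw [Set.indicator_of_mem h', Set.indicator_of_mem (hAA h')]
    · rw [Set.indicator_of_notMem h', abs_zero]
      exact abs_nonneg _
  obtain ⟨m, hm⟩ := ENNReal.exists_nat_mul_gt hn (ENNReal.one_ne_top)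
  have := hP.induction_on_measure_le (c := P A) (p := fun B _ => ∃ d, E.NormLE (B.indicator 1) d)
    (fun B hB h => hsmall B hB (by simp [h]))
    (fun B D m hB hD h ⟨d, hd⟩ => by
      obtain ⟨d', hd'⟩ := hsmall D hD h
      refine ⟨_, (hd.add hd').mono (measurable_one.indicator (hB.union hD)).aestronglyMeasurable
        (ae_of_all _ fun ω => ?_)⟩
      by_cases h1 : ω ∈ B <;> by_cases h2 : ω ∈ D <;> simp [h1, h2]
      norm_num)
    m Set.univ .univ (by simpa using hm.le)
  simpa using this

lemma NormLE.two_pow_dyadicRank [IsProbabilityMeasure P] {f : Ω → ℝ} {c d : ℝ}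
    (hf : E.NormLE f c) (hfm : Measurable f) (h1 : E.NormLE 1 d) :
    E.NormLE (fun ω => (2 : ℝ) ^ dyadicRank (f ω)) (d + |2| * c) := by
  have hpow : Measurable fun n : ℕ => (2 : ℝ) ^ n := measurable_from_top
  refine (h1.add (hf.abs.smul 2)).mono
    (hpow.comp (measurable_dyadicRank.comp hfm)).aestronglyMeasurable (ae_of_all _ fun ω => ?_)
  rw [abs_of_pos (by positivity)]
  refine le_trans ?_ (le_abs_self _)
  simpa using two_pow_dyadicRank_le (f ω)

/-- A rearrangement invariant space is closed under bounding the tails. -/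
lemma IsRearrangementInvariant.normLE_of_tail_le [IsProbabilityMeasure P] (hP : IsNonatomic P)
    (hri : E.IsRearrangementInvariant) {f g : Ω → ℝ} {c : ℝ} (hfE : E.NormLE f c)
    (hf : Measurable f) (hg : Measurable g)
    (hgf : ∀ t : ℝ, 0 ≤ t → P {ω | t < |g ω|} ≤ P {ω | t < |f ω|}) : ∃ d, E.NormLE g d := by
  obtain ⟨d, hd⟩ := hri.exists_normLE_one hP
  obtain ⟨h, -, hid, hgh⟩ := hP.exists_identDistrib_two_pow hf hg hgf
  obtain ⟨d', hd'⟩ := hri.normLE_of_identDistrib (hfE.two_pow_dyadicRank hf hd) hid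
  exact ⟨d', hd'.mono hg.aestronglyMeasurable hgh⟩

/-- The norms of the copies of a member `f` are bounded. If not, there are copies `h n` and levels
`a n` such that the part of `h n` with values in `(a n, a (n + 1)]` has norm greater than `n`,
because neither the part below a given level nor, by order continuity, the part above a high level
contributes much. The supremum of these parts has tails bounded by those of `f`, so it belongs to
the space, although it dominates them all. -/
lemma IsRearrangementInvariant.exists_normLE_copies [IsProbabilityMeasure P] (hP : IsNonatomic P)
    (hri : E.IsRearrangementInvariant) (hoc : E.HasOrderContinuousNorm) {f : Ω → ℝ} {c : ℝ}
    (hfE : E.NormLE f c) (hf : Measurable f) (hf0 : ∀ ω, 0 ≤ f ω) :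
    ∃ K, ∀ h : Ω → ℝ, Measurable h → IdentDistrib h f P P → E.NormLE h K := by
  classical
  obtain ⟨c1, hc1⟩ := hri.exists_normLE_one hP
  by_contra! hcon
  have hstep : ∀ (a : NNReal) (n : ℕ), ∃ (h : Ω → ℝ) (b : NNReal), a ≤ b ∧ Measurable h ∧
      IdentDistrib h f P P ∧ ¬ E.NormLE ((h ⁻¹' Set.Ioc (a : ℝ) b).indicator h) n := by
    intro a n
    obtain ⟨h, hm, hid, hno⟩ := hcon (|(a : ℝ)| * c1 + n + 1)
    obtain ⟨d, hd⟩ := hri.normLE_of_identDistrib hfE hid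
    have hh0 : ∀ᵐ ω ∂P, 0 ≤ h ω :=
      hid.symm.ae_mem_snd (t := Set.Ici 0) measurableSet_Ici (ae_of_all _ hf0)
    -- the part of `h` above the level `k` tends to zero in norm
    have hhigh := hoc.eventually_normLE (f := fun k : ℕ => (h ⁻¹' Set.Ioi (k : ℝ)).indicator h)
      (fun k => (hm.indicator (hm measurableSet_Ioi)).aestronglyMeasurable) hd
      (fun k => ae_of_all _ fun ω => by
        by_cases hω : ω ∈ h ⁻¹' Set.Ioi (k : ℝ)
        · rw [Set.indicator_of_mem hω]
        · rw [Set.indicator_of_notMem hω, abs_zero]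
          exact abs_nonneg _)
      (ae_of_all _ fun ω => by
        refine tendsto_const_nhds.congr' ?_
        filter_upwards [eventually_ge_atTop ⌈h ω⌉₊] with k hk
        refine (Set.indicator_of_notMem (fun hω => ?_) _).symm
        exact absurd (Nat.ceil_le.1 hk) (not_le.2 hω)) one_pos
    obtain ⟨k, hk, hak⟩ := (hhigh.and (eventually_ge_atTop ⌈(a : ℝ)⌉₊)).exists
    have hak' : (a : ℝ) ≤ k := Nat.ceil_le.1 hak
    refine ⟨h, k, by exact_mod_cast hak', hm, hid, fun hmid => hno ?_⟩
    refine (((hc1.smul a).add hmid).add hk).mono hm.aestronglyMeasurable ?_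
    filter_upwards [hh0] with ω hω
    rw [abs_of_nonneg hω]
    refine le_trans ?_ (le_abs_self _)
    simp only [Pi.add_apply, Pi.smul_apply, Pi.one_apply, smul_eq_mul, mul_one, Set.indicator_apply,
      Set.mem_preimage, Set.mem_Ioc, Set.mem_Ioi, NNReal.coe_natCast]
    have ha0 : (0 : ℝ) ≤ a := a.2
    rcases le_or_gt (h ω) a with h1 | h1
    · rw [if_neg (fun hh => absurd hh.1 (not_lt.2 h1)), if_neg (not_lt.2 (h1.trans hak'))]
      linarith
    · rcases le_or_gt (h ω) k with h2 | h2
      · rw [if_pos ⟨h1, h2⟩, if_neg (not_lt.2 h2)]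
        linarith
      · rw [if_neg (fun hh => absurd hh.2 (not_le.2 h2)), if_pos h2]
        linarith
  choose h b hab hm hid hno using hstep
  -- the levels, each one high enough for the part of the copy chosen at the previous level
  let a : ℕ → NNReal := fun n => Nat.rec (motive := fun _ => NNReal) 0 (fun n x => b x n) n
  have ha : Monotone fun n : ℕ => (a n : ℝ) := by
    refine monotone_nat_of_le_succ fun n => ?_
    exact NNReal.coe_le_coe.2 (hab (a n) n)
  let Z : ℕ → Ω → ℝ := fun n =>
    (h (a n) n ⁻¹' Set.Ioc (a n : ℝ) (a (n + 1))).indicator (h (a n) n)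
  have hZm : ∀ n, Measurable (Z n) := fun n => (hm _ _).indicator (hm _ _ measurableSet_Ioc)
  have hZ0 : ∀ n ω, 0 ≤ Z n ω := fun n ω => Set.indicator_apply_nonneg fun hω =>
    (a n).2.trans hω.1.le
  -- the value ranges of the parts are disjoint, so their tails add up to at most those of `f`
  have htail : ∀ t : ℝ, 0 ≤ t → P (⋃ n, {ω | t < Z n ω}) ≤ P {ω | t < |f ω|} := by
    intro t ht
    let I : ℕ → Set ℝ := fun n => Set.Ioi t ∩ Set.Ioc (a n : ℝ) (a (n + 1))
    have hIm : ∀ n, MeasurableSet (I n) := fun n => measurableSet_Ioi.inter measurableSet_Ioc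
    have hZI : ∀ n, {ω | t < Z n ω} = h (a n) n ⁻¹' I n := by
      intro n
      ext ω
      simp only [Z, Set.mem_ofPred_eq, Set.indicator_apply, I, Set.mem_preimage, Set.mem_inter_iff,
        Set.mem_Ioi]
      split_ifs with hω
      · exact ⟨fun h' => ⟨h', hω⟩, fun h' => h'.1⟩
      · exact ⟨fun h' => absurd h' (not_lt.2 ht), fun h' => absurd h'.2 hω⟩
    calc P (⋃ n, {ω | t < Z n ω}) ≤ ∑' n, P {ω | t < Z n ω} := measure_iUnion_le _
      _ = ∑' n, P (f ⁻¹' I n) := by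
          congr 1 with n
          rw [hZI, (hid (a n) n).measure_mem_eq (hIm n)]
      _ = P (⋃ n, f ⁻¹' I n) := by
          refine (measure_iUnion ?_ fun n => hf (hIm n)).symm
          intro m n hmn
          refine Disjoint.preimage _ ?_
          exact ((ha.pairwise_disjoint_on_Ioc_succ hmn).mono Set.inter_subset_right
            Set.inter_subset_right)
      _ ≤ P {ω | t < |f ω|} := by
          refine measure_mono (Set.iUnion_subset fun n ω hω => ?_)
          exact lt_of_lt_of_le (Set.mem_Ioi.1 hω.1) (le_abs_self _)
  -- off a null set the supremum below is not the junk value of an unbounded family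
  have hbdd : ∀ᵐ ω ∂P, BddAbove (Set.range fun n => Z n ω) := by
    have hnull : P (⋂ k : ℕ, ⋃ n, {ω | (k : ℝ) < Z n ω}) = 0 := by
      have hlim := tendsto_measure_iInter_atTop (μ := P) (s := fun k : ℕ => {ω | (k : ℝ) < |f ω|})
        (fun k => (measurableSet_lt measurable_const hf.abs).nullMeasurableSet)
        (fun k l hkl => Set.ofPred_subset_ofPred.2 fun ω hω =>
          lt_of_le_of_lt (Nat.cast_le.2 hkl) hω) ⟨0, measure_ne_top _ _⟩
      have hempty : ⋂ k : ℕ, {ω | (k : ℝ) < |f ω|} = ∅ := by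
        ext ω
        simp only [Set.mem_iInter, Set.mem_ofPred_eq, Set.mem_empty_iff_false, iff_false,
          not_forall, not_lt]
        exact exists_nat_ge _
      rw [hempty, measure_empty] at hlim
      refine le_antisymm (ge_of_tendsto' hlim fun k => ?_) bot_le
      exact (measure_mono (Set.iInter_subset _ k)).trans (htail k k.cast_nonneg)
    filter_upwards [measure_eq_zero_iff_ae_notMem.1 hnull] with ω hω
    simp only [Set.mem_iInter, Set.mem_iUnion, Set.mem_ofPred_eq, not_forall, not_exists,
      not_lt] at hω
    obtain ⟨k, hk⟩ := hω
    exact ⟨k, by rintro _ ⟨n, rfl⟩; exact hk n⟩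
  let W : Ω → ℝ := fun ω => ⨆ n, Z n ω
  have hW : Measurable W := .iSup hZm
  have hW0 : ∀ ω, 0 ≤ W ω := fun ω => Real.iSup_nonneg fun n => hZ0 n ω
  obtain ⟨d, hd⟩ := hri.normLE_of_tail_le hP hfE hf hW fun t ht => by
    refine le_trans (measure_mono fun ω hω => ?_) (htail t ht)
    have hω' : t < W ω := by rwa [← abs_of_nonneg (hW0 ω)]
    by_contra hnot
    simp only [Set.mem_iUnion, Set.mem_ofPred_eq, not_exists, not_lt] at hnot
    exact absurd hω' (not_lt.2 (ciSup_le hnot))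
  obtain ⟨n, hn⟩ := exists_nat_ge d
  refine hno (a n) n ((hd.mono (hZm n).aestronglyMeasurable ?_).weaken hn)
  filter_upwards [hbdd] with ω hω
  rw [abs_of_nonneg (hZ0 n ω), abs_of_nonneg (hW0 ω)]
  exact le_ciSup hω n

/-- `C` is a tail constant of `E` if the norm is monotone, up to the factor `C`, for the comparison
of the tails of absolute values. The norm is not assumed to depend on the distribution only; a tail
constant replaces this. -/
def IsTailConstant (E : BanachFunctionSpace P) (C : ℝ) : Prop :=
  0 < C ∧ ∀ (f g : Ω → ℝ) (c : ℝ), E.NormLE f c → Measurable f → Measurable g →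
    (∀ t : ℝ, 0 ≤ t → P {ω | t < |g ω|} ≤ P {ω | t < |f ω|}) → E.NormLE g (C * c)

/-- A rearrangement invariant space with order continuous norm has a tail constant. Otherwise an
absolutely convergent series of counterexamples would have a dominating member whose copies have
unbounded norms. -/
lemma IsRearrangementInvariant.exists_isTailConstant [IsProbabilityMeasure P]
    (hP : IsNonatomic P) (hri : E.IsRearrangementInvariant) (hoc : E.HasOrderContinuousNorm) :
    ∃ C : ℝ, E.IsTailConstant C := by
  unfold IsTailConstant
  obtain ⟨c1, hc1⟩ := hri.exists_normLE_one hP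
  by_contra! hcon
  have hcon' : ∀ n : ℕ, ∃ (f g : Ω → ℝ) (c : ℝ), 0 < c ∧ E.NormLE f c ∧ Measurable f ∧
      Measurable g ∧ (∀ t : ℝ, 0 ≤ t → P {ω | t < |g ω|} ≤ P {ω | t < |f ω|}) ∧
      ¬ E.NormLE g (4 ^ n * c) := by
    intro n
    obtain ⟨f, g, c, hf, hfm, hgm, hgf, hno⟩ := hcon (4 ^ n) (by positivity)
    -- enlarging the bound `c` slightly makes it positive, so that it can be divided by
    obtain ⟨ε, hε, hno'⟩ : ∃ ε > 0, ¬ E.NormLE g (4 ^ n * c + ε) := by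
      by_contra! h
      exact hno (NormLE.of_forall_pos h)
    refine ⟨f, g, c + ε / 4 ^ n, add_pos_of_nonneg_of_pos hf.nonneg (by positivity),
      hf.weaken (by simp; positivity), hfm, hgm, hgf, ?_⟩
    rwa [mul_add, mul_div_cancel₀ _ (by positivity)]
  choose f g c hc hf hfm hgm hgf hno using hcon'
  let a : ℕ → ℝ := fun n => (1 / 2) ^ n / c n
  have ha : ∀ n, 0 < a n := fun n => div_pos (by positivity) (hc n)
  obtain ⟨Z, d, hZ, hle⟩ := exists_normLE_sum_abs_le (E := E) (u := fun n => a n • f n) fun n =>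
    ((hf n).smul (a n)).weaken (by
      rw [abs_of_pos (ha n), div_mul_cancel₀ _ (hc n).ne'])
  have hZm := hZ.aestronglyMeasurable
  have hZ' : E.NormLE (hZm.mk Z) d := hZ.congr hZm.ae_eq_mk
  have hmZ : Measurable (hZm.mk Z) := hZm.stronglyMeasurable_mk.measurable
  have htail : ∀ n (t : ℝ), 0 ≤ t → P {ω | t < |(a n • g n) ω|} ≤ P {ω | t < |hZm.mk Z ω|} := by
    intro n t ht
    have hscale : ∀ (f : Ω → ℝ), {ω | t < |(a n • f) ω|} = {ω | t / a n < |f ω|} := by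
      intro f
      ext ω
      simp only [Pi.smul_apply, smul_eq_mul, abs_mul, abs_of_pos (ha n), Set.mem_ofPred_eq,
        div_lt_iff₀' (ha n)]
    rw [hscale (g n)]
    refine (hgf n _ (div_nonneg ht (ha n).le)).trans ?_
    rw [← hscale (f n)]
    refine measure_mono_ae ?_
    filter_upwards [hle, hZm.ae_eq_mk] with ω h1 h2 h3
    refine lt_of_lt_of_le h3 (le_trans ?_ (le_abs_self _))
    rw [← h2]
    refine le_trans ?_ (h1 (n + 1))
    exact Finset.single_le_sum (f := fun k => |(a k • f k) ω|) (fun _ _ => abs_nonneg _)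
      (Finset.self_mem_range_succ n)
  have hpow : Measurable fun n : ℕ => (2 : ℝ) ^ n := measurable_from_top
  obtain ⟨K, hK⟩ := hri.exists_normLE_copies hP hoc (hZ'.two_pow_dyadicRank hmZ hc1)
    (hpow.comp (measurable_dyadicRank.comp hmZ)) fun ω => by positivity
  have hgK : ∀ n, E.NormLE (a n • g n) K := by
    intro n
    obtain ⟨h, hm, hid, hgh⟩ := hP.exists_identDistrib_two_pow hmZ ((hgm n).const_smul (a n))
      (htail n)
    exact (hK h hm hid).mono ((hgm n).const_smul (a n)).aestronglyMeasurable hgh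
  obtain ⟨n, hn⟩ := pow_unbounded_of_one_lt K (one_lt_two)
  refine hno n ?_
  have := (hgK n).smul (a n)⁻¹
  rw [inv_smul_smul₀ (ha n).ne'] at this
  refine this.weaken ?_
  rw [abs_of_pos (inv_pos.2 (ha n))]
  have e : (a n)⁻¹ = 2 ^ n * c n := by
    simp [a, mul_comm]
  rw [e, show (4 : ℝ) ^ n = 2 ^ n * 2 ^ n by rw [← mul_pow]; norm_num]
  have hp : (0 : ℝ) < 2 ^ n * c n := mul_pos (by positivity) (hc n)
  nlinarith [mul_le_mul_of_nonneg_left hn.le hp.le]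

/-! ### Averages of copies and the embedding into `L¹` -/

variable {f g : Ω → ℝ} {c d C : ℝ}

lemma IsTailConstant.normLE_of_identDistrib (hC : E.IsTailConstant C) (hf : E.NormLE f c)
    (hfm : Measurable f) (hgm : Measurable g) (h : IdentDistrib g f P P) : E.NormLE g (C * c) := by
  refine hC.2 f g c hf hfm hgm fun t _ => (h.measure_mem_eq (s := {x | t < |x|}) ?_).le
  exact measurableSet_lt measurable_const measurable_abs

lemma NormLE.const (h1 : E.NormLE 1 d) (a : ℝ) : E.NormLE (fun _ => a) (|a| * d) :=
  (h1.smul a).congr (ae_of_all _ fun ω => by simp)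

lemma NormLE.of_abs_le (h1 : E.NormLE 1 d) (hf : AEStronglyMeasurable f P) {a : ℝ} (ha : 0 ≤ a)
    (h : ∀ᵐ ω ∂P, |f ω| ≤ a) : E.NormLE f (a * d) := by
  have := h1.const a
  rw [abs_of_nonneg ha] at this
  refine this.mono hf ?_
  filter_upwards [h] with ω hω
  rwa [abs_of_nonneg ha]

lemma NormLE.average {Y : ℕ → Ω → ℝ} (hY : ∀ i, E.NormLE (Y i) c) {n : ℕ} (hn : n ≠ 0) :
    E.NormLE (fun ω => (∑ i ∈ Finset.range n, Y i ω) / n) c := by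
  have := (NormLE.sum (s := Finset.range n) fun i _ => hY i).smul (n : ℝ)⁻¹
  refine (this.congr (ae_of_all _ fun ω => ?_)).weaken (le_of_eq ?_)
  · simp [div_eq_inv_mul]
  · have hn' : (n : ℝ) ≠ 0 := Nat.cast_ne_zero.2 hn
    rw [Finset.sum_const, Finset.card_range, nsmul_eq_mul, abs_of_pos (by positivity),
      inv_mul_cancel_left₀ hn']

/-- Truncations at high levels approximate in norm. -/
lemma HasOrderContinuousNorm.eventually_normLE_sub_clamp (hoc : E.HasOrderContinuousNorm)
    (hf : E.NormLE f c) (hfm : Measurable f) {ε : ℝ} (hε : 0 < ε) :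
    ∀ᶠ k : ℕ in atTop, E.NormLE (fun ω => f ω - clamp k (f ω)) ε := by
  refine hoc.eventually_normLE (f := fun (k : ℕ) ω => f ω - clamp k (f ω))
    (fun k => (hfm.sub ((measurable_clamp k).comp hfm)).aestronglyMeasurable) (hf.smul 2)
    (fun k => ae_of_all _ fun ω => ?_) (ae_of_all _ fun ω => ?_) hε
  · have h1 := abs_clamp_le_abs (Nat.cast_nonneg k) (f ω)
    have h2 := abs_sub (f ω) (clamp k (f ω))
    rw [Pi.smul_apply, smul_eq_mul, abs_mul, abs_two]
    linarith
  · refine tendsto_const_nhds.congr' ?_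
    filter_upwards [eventually_ge_atTop ⌈|f ω|⌉₊] with k hk
    rw [clamp_eq_self (Nat.ceil_le.1 hk), sub_self]

/-- Members are approximated in norm by simple functions. -/
lemma HasOrderContinuousNorm.exists_simpleFunc (hoc : E.HasOrderContinuousNorm)
    (hf : E.NormLE f c) (hfm : Measurable f) {ε : ℝ} (hε : 0 < ε) :
    ∃ s : SimpleFunc Ω ℝ, E.NormLE (f - s) ε := by
  let s := SimpleFunc.approxOn f hfm Set.univ 0 (Set.mem_univ _)
  have h := hoc.eventually_normLE (f := fun n => f - s n) (ε := ε)
    (fun n => (hfm.sub (s n).measurable).aestronglyMeasurable) (hf.smul 3)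
    (fun n => ae_of_all _ fun ω => ?_) (ae_of_all _ fun ω => ?_) hε
  · obtain ⟨n, hn⟩ := h.exists
    exact ⟨s n, hn⟩
  · have h1 : ‖s n ω‖ ≤ ‖f ω‖ + ‖f ω‖ := SimpleFunc.norm_approxOn_zero_le hfm (Set.mem_univ _) ω n
    have h2 := abs_sub (f ω) (s n ω)
    rw [Real.norm_eq_abs, Real.norm_eq_abs] at h1
    rw [Pi.smul_apply, smul_eq_mul, abs_mul, abs_of_pos (by norm_num : (0 : ℝ) < 3), Pi.sub_apply]
    linarith
  · have h1 : Tendsto (fun n => s n ω) atTop (𝓝 (f ω)) :=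
      SimpleFunc.tendsto_approxOn hfm (Set.mem_univ _) (by simp)
    simpa using h1.const_sub (f ω)

/-- Convergence in norm of the averages in the law of large numbers, for bounded functions of the
copies. -/
lemma HasOrderContinuousNorm.eventually_normLE_average_sub (hoc : E.HasOrderContinuousNorm)
    (h1 : E.NormLE 1 d) {Y : ℕ → Ω → ℝ} (hY : ∀ i, Measurable (Y i)) {X : Ω → ℝ}
    {s : SimpleFunc Ω ℝ} {g : ℝ → ℝ} (hg : Measurable g) {K : ℝ} (hK0 : 0 ≤ K)
    (hK : ∀ x, |g x| ≤ K)
    (hlim : ∀ᵐ ω ∂P, Tendsto (fun n : ℕ => (∑ i ∈ Finset.range n, g (Y i ω)) / n) atTop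
      (𝓝 (fiberMean P s (fun x => g (X x)) ω))) {ε : ℝ} (hε : 0 < ε) :
    ∀ᶠ n : ℕ in atTop, E.NormLE (fun ω => (∑ i ∈ Finset.range n, g (Y i ω)) / n -
      fiberMean P s (fun x => g (X x)) ω) ε := by
  have hbound : ∀ (n : ℕ) (ω : Ω), |(∑ i ∈ Finset.range n, g (Y i ω)) / n| ≤ K := by
    intro n ω
    rcases Nat.eq_zero_or_pos n with rfl | hn
    · simpa using hK0
    · have hn' : (0 : ℝ) < n := Nat.cast_pos.2 hn
      rw [abs_div, abs_of_pos hn', div_le_iff₀ hn']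
      refine (Finset.abs_sum_le_sum_abs _ _).trans ?_
      refine (Finset.sum_le_card_nsmul _ _ K fun i _ => hK _).trans (le_of_eq ?_)
      rw [Finset.card_range, nsmul_eq_mul, mul_comm]
  refine hoc.eventually_normLE (fun n => ?_) (h1.const (2 * K)) (fun n => ?_) ?_ hε
  · refine Measurable.aestronglyMeasurable (Measurable.sub (Measurable.div_const ?_ _)
      (measurable_fiberMean P s _))
    exact Finset.measurable_fun_sum _ fun i _ => hg.comp (hY i)
  · filter_upwards [hlim] with ω hω
    have h2 : |fiberMean P s (fun x => g (X x)) ω| ≤ K :=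
      le_of_tendsto' hω.abs fun n => hbound n ω
    refine (abs_sub _ _).trans (le_trans ?_ (le_abs_self _))
    linarith [hbound n ω]
  · filter_upwards [hlim] with ω hω
    simpa using hω.sub_const (fiberMean P s (fun x => g (X x)) ω)

/-- Conditioning a bounded function on a finite partition increases its norm at most by the tail
constant. -/
lemma IsTailConstant.normLE_fiberMean_of_bounded [IsProbabilityMeasure P] (hP : IsNonatomic P)
    (hoc : E.HasOrderContinuousNorm) (hC : E.IsTailConstant C) (h1 : E.NormLE 1 d)
    (hf : E.NormLE f c) (hfm : Measurable f) {K : ℝ} (hK0 : 0 ≤ K) (hK : ∀ ω, |f ω| ≤ K)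
    (s : SimpleFunc Ω ℝ) : E.NormLE (fiberMean P s f) (C * c) := by
  obtain ⟨Y, hYm, hYi, hlim⟩ := hP.exists_copies hfm s
  have hff : (fun x => clamp K (f x)) = f := funext fun x => clamp_eq_self (hK x)
  refine NormLE.of_forall_pos fun ε hε => ?_
  obtain ⟨n, hn, hn0⟩ := ((hoc.eventually_normLE_average_sub h1 hYm (measurable_clamp K) hK0
    (abs_clamp_le hK0) (hlim _ (measurable_clamp K) ⟨K, abs_clamp_le hK0⟩) hε).and
    (eventually_ne_atTop 0)).exists
  have hYE : ∀ i, E.NormLE (fun ω => clamp K (Y i ω)) (C * c) := by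
    intro i
    refine hC.normLE_of_identDistrib hf hfm ((measurable_clamp K).comp (hYm i)) ?_
    have := (hYi i).comp (measurable_clamp K)
    rwa [show clamp K ∘ f = f from hff] at this
  refine ((NormLE.average hYE hn0).sub hn).congr (ae_of_all _ fun ω => ?_)
  simp [hff]

/-- A rearrangement invariant space with order continuous norm embeds continuously into `L¹`: the
norm of the constant `∫ |f|` is controlled by that of `|f|`, first for truncations. -/
lemma IsTailConstant.exists_eLpNorm_le [IsProbabilityMeasure P] (hP : IsNonatomic P)
    (hoc : E.HasOrderContinuousNorm) (hC : E.IsTailConstant C) (h1 : E.NormLE 1 d) :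
    ∃ D : ℝ, 0 < D ∧ ∀ (f : Ω → ℝ) (c : ℝ), E.NormLE f c →
      eLpNorm f 1 P ≤ ENNReal.ofReal (D * c) := by
  obtain ⟨U, hU, -⟩ := h1
  have hU0 : 0 < E.nrm U := by
    refine lt_of_le_of_ne (apply_nonneg _ _) fun h => ?_
    have h0 : E.NormLE 1 0 := ⟨U, hU, h.ge⟩
    obtain ⟨ω, hω⟩ := h0.ae_eq_zero.exists
    exact one_ne_zero hω
  have hconst : ∀ m c : ℝ, 0 ≤ m → E.NormLE (fun _ => m) c → m * E.nrm U ≤ c := by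
    intro m c hm h
    have := normLE_coe_iff.1 (h.congr (g := ((m • U : E.carrier) : Ω →ₘ[P] ℝ)) (by
      refine EventuallyEq.trans ?_ (AEEqFun.coeFn_smul m (U : Ω →ₘ[P] ℝ)).symm
      filter_upwards [hU] with ω hω
      simp [hω]))
    rwa [map_smul_eq_mul, Real.norm_of_nonneg hm] at this
  have hmeas : ∀ (f : Ω → ℝ) (c : ℝ), E.NormLE f c → Measurable f →
      eLpNorm f 1 P ≤ ENNReal.ofReal (C / E.nrm U * c) := by
    intro f c hf hfm
    have hmin : ∀ k : ℕ, ∫⁻ ω, ENNReal.ofReal (min |f ω| k) ∂P ≤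
        ENNReal.ofReal (C / E.nrm U * c) := by
      intro k
      have hm : Measurable fun ω => min |f ω| (k : ℝ) := hfm.abs.min measurable_const
      have h0 : ∀ ω, 0 ≤ min |f ω| (k : ℝ) := fun ω => le_min (abs_nonneg _) k.cast_nonneg
      have hle : ∀ ω, |min |f ω| (k : ℝ)| ≤ k := fun ω => by
        rw [abs_of_nonneg (h0 ω)]; exact min_le_right _ _
      have hE : E.NormLE (fun ω => min |f ω| (k : ℝ)) c :=
        hf.mono hm.aestronglyMeasurable (ae_of_all _ fun ω => by
          rw [abs_of_nonneg (h0 ω)]; exact min_le_left _ _)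
      have hmean := hC.normLE_fiberMean_of_bounded hP hoc ⟨U, hU, le_rfl⟩ hE hm k.cast_nonneg hle
        (SimpleFunc.const Ω 0)
      have hi : Integrable (fun ω => min |f ω| (k : ℝ)) P :=
        Integrable.of_bound hm.aestronglyMeasurable k (ae_of_all _ hle)
      rw [← ofReal_integral_eq_lintegral_ofReal hi (ae_of_all _ h0)]
      refine ENNReal.ofReal_le_ofReal ?_
      rw [div_mul_eq_mul_div, le_div_iff₀ hU0]
      refine hconst _ _ (integral_nonneg h0) (hmean.congr (ae_of_all _ fun ω => ?_))
      have e : (SimpleFunc.const Ω (0 : ℝ)) ⁻¹' {(SimpleFunc.const Ω (0 : ℝ)) ω} = Set.univ := by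
        ext; simp
      rw [fiberMean_apply, e]
      simp
    rw [eLpNorm_one_eq_lintegral_enorm]
    have hlim : ∀ ω, Tendsto (fun k : ℕ => ENNReal.ofReal (min |f ω| k)) atTop (𝓝 ‖f ω‖ₑ) := by
      intro ω
      refine tendsto_const_nhds.congr' ?_
      filter_upwards [eventually_ge_atTop ⌈|f ω|⌉₊] with k hk
      rw [min_eq_left (Nat.ceil_le.1 hk), ← Real.norm_eq_abs, ofReal_norm]
    calc ∫⁻ ω, ‖f ω‖ₑ ∂P
        = ∫⁻ ω, liminf (fun k : ℕ => ENNReal.ofReal (min |f ω| k)) atTop ∂P := by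
          simp_rw [(hlim _).liminf_eq]
      _ ≤ liminf (fun k : ℕ => ∫⁻ ω, ENNReal.ofReal (min |f ω| k) ∂P) atTop :=
          lintegral_liminf_le fun k => (hfm.abs.min measurable_const).ennreal_ofReal
      _ ≤ ENNReal.ofReal (C / E.nrm U * c) :=
          liminf_le_of_le (by isBoundedDefault) fun b hb => by
            obtain ⟨k, hk⟩ := hb.exists
            exact hk.trans (hmin k)
  refine ⟨C / E.nrm U, div_pos hC.1 hU0, fun f c hf => ?_⟩
  have hfm := hf.aestronglyMeasurable
  rw [eLpNorm_congr_ae hfm.ae_eq_mk]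
  exact hmeas _ _ (hf.congr hfm.ae_eq_mk) hfm.stronglyMeasurable_mk.measurable

/-- The conditional expectation of a member on a finite partition is a limit in norm of averages of
copies of that member: the law of large numbers for truncations of the copies, the remainders being
controlled by the tail constant. -/
lemma IsTailConstant.exists_average_normLE [IsProbabilityMeasure P] (hP : IsNonatomic P)
    (hoc : E.HasOrderContinuousNorm) (hC : E.IsTailConstant C) (h1 : E.NormLE 1 d)
    (hf : E.NormLE f c) (hfm : Measurable f) (s : SimpleFunc Ω ℝ) {ε : ℝ} (hε : 0 < ε) :
    ∃ (Y : ℕ → Ω → ℝ) (n : ℕ), n ≠ 0 ∧ (∀ i, Measurable (Y i)) ∧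
      (∀ i, IdentDistrib (Y i) f P P) ∧
      E.NormLE (fun ω => (∑ i ∈ Finset.range n, Y i ω) / n - fiberMean P s f ω) ε := by
  obtain ⟨D, hD0, hD⟩ := hC.exists_eLpNorm_le hP hoc h1
  obtain ⟨R, hR0, hR⟩ := exists_abs_fiberMean_le P s
  have hd0 := h1.nonneg
  have hC0 := hC.1
  have hint : ∀ (h : Ω → ℝ) (e : ℝ), E.NormLE h e → Integrable h P := fun h e he =>
    memLp_one_iff_integrable.1 ⟨he.aestronglyMeasurable, (hD h e he).trans_lt ENNReal.ofReal_lt_top⟩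
  obtain ⟨δ, hδ, hδε⟩ : ∃ δ > 0, C * δ + R * (D * δ) * d ≤ ε / 2 := by
    refine ⟨ε / 2 / (C + R * D * d), by positivity, le_of_eq ?_⟩
    field_simp
  obtain ⟨Y, hYm, hYi, hlim⟩ := hP.exists_copies hfm s
  obtain ⟨k, hk⟩ := (hoc.eventually_normLE_sub_clamp hf hfm hδ).exists
  have hcm := measurable_clamp k
  have hcb := abs_clamp_le (K := k) (Nat.cast_nonneg k)
  obtain ⟨n, hn, hn0⟩ := ((hoc.eventually_normLE_average_sub h1 hYm hcm k.cast_nonneg hcb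
    (hlim _ hcm ⟨k, hcb⟩) (half_pos hε)).and (eventually_ne_atTop 0)).exists
  refine ⟨Y, n, hn0, hYm, hYi, ?_⟩
  have hrem :
      E.NormLE (fun ω => (∑ i ∈ Finset.range n, (Y i ω - clamp k (Y i ω))) / n) (C * δ) := by
    refine NormLE.average (Y := fun i ω => Y i ω - clamp k (Y i ω)) (fun i => ?_) hn0
    have hm : Measurable fun x : ℝ => x - clamp k x := measurable_id.sub hcm
    exact hC.normLE_of_identDistrib hk (hm.comp hfm) (hm.comp (hYm i)) ((hYi i).comp hm)
  have hmean : E.NormLE (fiberMean P s (fun ω => f ω - clamp k (f ω))) (R * (D * δ) * d) := by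
    refine h1.of_abs_le (measurable_fiberMean P s _).aestronglyMeasurable
      (by positivity) (ae_of_all _ (hR _ _ fun y _ => ?_))
    refine (abs_integral_le_integral_abs).trans ?_
    have hi := hint _ _ hk
    refine (setIntegral_le_integral hi.abs (ae_of_all _ fun ω => abs_nonneg _)).trans ?_
    have h2 := hD _ _ hk
    rw [eLpNorm_one_eq_lintegral_enorm] at h2
    have h3 := integral_norm_eq_lintegral_enorm hi.aestronglyMeasurable
    simp only [Real.norm_eq_abs] at h3
    rw [h3]
    exact ENNReal.toReal_le_of_le_ofReal (by positivity) h2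
  have hfib : fiberMean P s (fun ω => f ω - clamp k (f ω)) =
      fiberMean P s f - fiberMean P s fun ω => clamp k (f ω) :=
    fiberMean_sub s (hint _ _ hf) (Integrable.of_bound (hcm.comp hfm).aestronglyMeasurable k
      (ae_of_all _ fun ω => hcb _))
  rw [hfib] at hmean
  refine ((hn.add (hrem.sub hmean)).congr (ae_of_all _ fun ω => ?_)).weaken (by linarith)
  simp only [Pi.add_apply, Pi.sub_apply, Finset.sum_sub_distrib]
  ring

lemma IsTailConstant.normLE_fiberMean [IsProbabilityMeasure P] (hP : IsNonatomic P)
    (hoc : E.HasOrderContinuousNorm) (hC : E.IsTailConstant C) (h1 : E.NormLE 1 d)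
    (hf : E.NormLE f c) (hfm : Measurable f) (s : SimpleFunc Ω ℝ) :
    E.NormLE (fiberMean P s f) (C * c) := by
  refine NormLE.of_forall_pos fun ε hε => ?_
  obtain ⟨Y, n, hn0, hYm, hYi, hY⟩ := hC.exists_average_normLE hP hoc h1 hf hfm s hε
  have hYE : ∀ i, E.NormLE (Y i) (C * c) := fun i =>
    hC.normLE_of_identDistrib hf hfm (hYm i) (hYi i)
  refine ((NormLE.average hYE hn0).sub hY).congr (ae_of_all _ fun ω => ?_)
  simp

/-- Members are approximated in norm by their conditional expectations on finite partitions. -/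
lemma IsTailConstant.exists_normLE_fiberMean_sub [IsProbabilityMeasure P] (hP : IsNonatomic P)
    (hoc : E.HasOrderContinuousNorm) (hC : E.IsTailConstant C) (h1 : E.NormLE 1 d)
    (hf : E.NormLE f c) (hfm : Measurable f) {ε : ℝ} (hε : 0 < ε) :
    ∃ s : SimpleFunc Ω ℝ, E.NormLE (fiberMean P s f - f) ε := by
  obtain ⟨D, hD0, hD⟩ := hC.exists_eLpNorm_le hP hoc h1
  have hC0 := hC.1
  obtain ⟨s, hs⟩ := hoc.exists_simpleFunc hf hfm (ε := ε / (C + 1)) (by positivity)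
  refine ⟨s, ?_⟩
  have hfi : Integrable f P :=
    memLp_one_iff_integrable.1 ⟨hf.aestronglyMeasurable, (hD f c hf).trans_lt ENNReal.ofReal_lt_top⟩
  have hsi : Integrable s P := s.integrable_of_isFiniteMeasure
  have hmean := hC.normLE_fiberMean hP hoc h1 hs (hfm.sub s.measurable) s
  rw [fiberMean_sub s hfi hsi] at hmean
  refine ((hmean.sub hs).congr ?_).weaken (le_of_eq (by field_simp))
  filter_upwards [fiberMean_self (P := P) s] with ω hω
  simp only [Pi.sub_apply, hω]
  ring

/-! ### Uniform integrability of norm balls -/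

/-- If the norms of indicators are at most proportional to the measures of the sets, then the norm
is controlled by that of `L¹` on simple functions. -/
lemma normLE_simpleFunc [IsFiniteMeasure P] {K : ℝ}
    (hK : ∀ B, MeasurableSet B → E.NormLE (B.indicator 1) (K * P.real B)) (hK0 : 0 ≤ K)
    (s : SimpleFunc Ω ℝ) (hc : 0 ≤ c) (hs : eLpNorm s 1 P ≤ ENNReal.ofReal c) :
    E.NormLE s (K * c) := by
  have hsum : E.NormLE (∑ y ∈ s.range, y • (s ⁻¹' {y}).indicator (1 : Ω → ℝ)) _ :=
    NormLE.sum fun y _ => (hK _ (s.measurableSet_fiber y)).smul y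
  refine (hsum.congr (ae_of_all _ fun ω => ?_)).weaken ?_
  · rw [Finset.sum_apply, Finset.sum_eq_single (s ω)]
    · simp
    · intro y _ hy
      have : ω ∉ s ⁻¹' {y} := fun h => hy h.symm
      simp [this]
    · exact fun h => absurd (s.mem_range_self ω) h
  · have h1 : eLpNorm s 1 P = ∑ y ∈ s.range, ‖y‖ₑ * P (s ⁻¹' {y}) := by
      rw [eLpNorm_one_eq_lintegral_enorm, ← SimpleFunc.map_lintegral,
        ← SimpleFunc.lintegral_eq_lintegral]
      rfl
    have h2 : ∑ y ∈ s.range, |y| * P.real (s ⁻¹' {y}) ≤ c := by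
      have h3 := ENNReal.toReal_le_of_le_ofReal hc hs
      rw [h1, ENNReal.toReal_sum fun y _ =>
        ENNReal.mul_ne_top enorm_ne_top (measure_ne_top _ _)] at h3
      simpa [ENNReal.toReal_mul, Measure.real] using h3
    calc ∑ y ∈ s.range, |y| * (K * P.real (s ⁻¹' {y}))
        = K * ∑ y ∈ s.range, |y| * P.real (s ⁻¹' {y}) := by
          rw [Finset.mul_sum]
          exact Finset.sum_congr rfl fun y _ => by ring
      _ ≤ K * c := mul_le_mul_of_nonneg_left h2 hK0

/-- If the norms of indicators are at most proportional to the measures of the sets, then the space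
is `L¹`. -/
lemma IsTailConstant.carrier_eq_Lp_one [IsProbabilityMeasure P] (hP : IsNonatomic P)
    (hoc : E.HasOrderContinuousNorm) (hC : E.IsTailConstant C) (h1 : E.NormLE 1 d) {K : ℝ}
    (hK0 : 0 < K) (hK : ∀ B, MeasurableSet B → E.NormLE (B.indicator 1) (K * P.real B)) :
    (E.carrier : Set (Ω →ₘ[P] ℝ)) = (Lp ℝ 1 P : Set (Ω →ₘ[P] ℝ)) := by
  obtain ⟨D, hD0, hD⟩ := hC.exists_eLpNorm_le hP hoc h1
  ext X
  constructor
  · intro hX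
    exact Lp.mem_Lp_iff_eLpNorm_lt_top.2
      ((hD X _ (normLE_coe (E := E) ⟨X, hX⟩)).trans_lt ENNReal.ofReal_lt_top)
  · intro hX
    have hXL : MemLp X 1 P :=
      ⟨X.aestronglyMeasurable, Lp.mem_Lp_iff_eLpNorm_lt_top.1 hX⟩
    choose s hs _ using fun n : ℕ => hXL.exists_simpleFunc_eLpNorm_sub_lt ENNReal.one_ne_top
      (ε := ENNReal.ofReal ((1 / 2) ^ n)) (ENNReal.ofReal_pos.2 (by positivity)).ne'
    have hsX : ∀ n, eLpNorm ((s n : Ω → ℝ) - (X : Ω → ℝ)) 1 P ≤ ENNReal.ofReal ((1 / 2) ^ n) := by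
      intro n
      rw [eLpNorm_sub_comm]; exact (hs n).le
    have hsm : ∀ n, AEStronglyMeasurable (s n) P := fun n => (s n).aestronglyMeasurable
    have hpow : ∀ ε : ℝ, 0 < ε → ∃ N : ℕ, ∀ n, N ≤ n → (1 / 2 : ℝ) ^ n ≤ ε := by
      intro ε hε
      obtain ⟨N, hN⟩ := exists_pow_lt_of_lt_one hε (by norm_num : (1 / 2 : ℝ) < 1)
      exact ⟨N, fun n hn =>
        (pow_le_pow_of_le_one (by norm_num) (by norm_num) hn).trans hN.le⟩
    obtain ⟨g, c, hg, hlim⟩ := exists_normLE_limit (E := E) (f := fun n => s n)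
      (fun n => ⟨_, normLE_simpleFunc hK hK0.le (s n) ENNReal.toReal_nonneg
        (ENNReal.ofReal_toReal ((s n).memLp_of_isFiniteMeasure 1 P).2.ne).ge⟩) fun ε hε => by
        obtain ⟨N, hN⟩ := hpow (ε / (2 * K)) (by positivity)
        refine ⟨N, fun m n hm hn => ?_⟩
        have h2 : eLpNorm (s m - s n : SimpleFunc Ω ℝ) 1 P ≤ ENNReal.ofReal (ε / K) := by
          have e : ((s m - s n : SimpleFunc Ω ℝ) : Ω → ℝ) =
              (s m - (X : Ω → ℝ)) + ((X : Ω → ℝ) - s n) := by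
            rw [SimpleFunc.coe_sub]; abel
          rw [e]
          refine (eLpNorm_add_le ((hsm m).sub hXL.1) (hXL.1.sub (hsm n)) le_rfl).trans ?_
          refine (add_le_add (hsX m) (hs n).le).trans ?_
          rw [← ENNReal.ofReal_add (by positivity) (by positivity)]
          refine ENNReal.ofReal_le_ofReal ?_
          have := hN m hm
          have := hN n hn
          have e2 : ε / K = ε / (2 * K) + ε / (2 * K) := by field_simp; norm_num
          linarith
        refine (normLE_simpleFunc hK hK0.le _ (by positivity) h2).weaken (le_of_eq ?_)
        field_simp
    have hXg : eLpNorm ((X : Ω → ℝ) - g) 1 P = 0 := by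
      refine le_antisymm (ENNReal.le_of_forall_pos_le_add fun ε hε _ => ?_) bot_le
      obtain ⟨N, hN⟩ := hpow (ε / 2) (by positivity)
      obtain ⟨N', hN'⟩ := hlim (ε / (2 * D)) (by positivity)
      have h2 := hN _ (le_max_left N N')
      have h3 := hD _ _ (hN' _ (le_max_right N N'))
      set n := max N N'
      have e : (X : Ω → ℝ) - g = ((X : Ω → ℝ) - s n) + (s n - g) := by abel
      rw [e]
      refine (eLpNorm_add_le (hXL.1.sub (hsm n)) ((hsm n).sub hg.aestronglyMeasurable)
        le_rfl).trans ?_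
      refine (add_le_add (hs n).le h3).trans ?_
      rw [← ENNReal.ofReal_add (by positivity) (by positivity), zero_add,
        ← ENNReal.ofReal_coe_nnreal]
      refine ENNReal.ofReal_le_ofReal ?_
      have e2 : D * (ε / (2 * D)) = (ε : ℝ) / 2 := by field_simp
      linarith
    rw [eLpNorm_eq_zero_iff (hXL.1.sub hg.aestronglyMeasurable) one_ne_zero] at hXg
    obtain ⟨Y, hY, -⟩ := hg
    have : X = Y := AEEqFun.ext (by
      filter_upwards [hXg, hY] with ω h2 h3
      rw [h3]
      exact sub_eq_zero.1 h2)
    rw [this]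
    exact Y.2

/-- Norm balls of a rearrangement invariant space other than `L¹` are uniformly integrable. If not,
there are sets `A` of arbitrarily small measure that carry a fixed amount `ε` of the integral of
some `|f|` in the ball. Averaging `|f|` over `A` bounds the norm of the indicator of `A` by a
multiple of `P A`, and covering arbitrary sets by copies of such small sets gives the same bound for
all indicators. -/
lemma IsTailConstant.exists_forall_eLpNorm_indicator_le [IsProbabilityMeasure P]
    (hP : IsNonatomic P) (hoc : E.HasOrderContinuousNorm) (hC : E.IsTailConstant C)
    (h1 : E.NormLE 1 d) (hne : (E.carrier : Set (Ω →ₘ[P] ℝ)) ≠ (Lp ℝ 1 P : Set (Ω →ₘ[P] ℝ)))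
    (M : ℝ) {ε : ℝ} (hε : 0 < ε) :
    ∃ δ > 0, ∀ f : Ω → ℝ, E.NormLE f M → Measurable f → ∀ A, MeasurableSet A →
      P A ≤ ENNReal.ofReal δ → eLpNorm (A.indicator f) 1 P ≤ ENNReal.ofReal ε := by
  by_contra! hcon
  obtain ⟨D, hD0, hD⟩ := hC.exists_eLpNorm_le hP hoc h1
  have hC0 := hC.1
  let M' := max M 1
  have hM' : 0 < M' := lt_max_of_lt_right one_pos
  let K := C * (C * M') / ε
  have hK : 0 < K := by positivity
  refine hne (hC.carrier_eq_Lp_one hP hoc h1 hK fun B hB => ?_)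
  refine NormLE.of_forall_pos fun η hη => ?_
  obtain ⟨f, hf, hfm, A, hA, hPA, hlt⟩ := hcon (η / K) (by positivity)
  replace hf : E.NormLE f M' := hf.weaken (le_max_left _ _)
  have hA0 : P A ≠ 0 := by
    intro h
    have h0 : A.indicator f =ᵐ[P] 0 := by
      filter_upwards [measure_eq_zero_iff_ae_notMem.1 h] with ω hω using
        Set.indicator_of_notMem hω f
    rw [eLpNorm_congr_ae h0, eLpNorm_zero] at hlt
    exact not_lt_bot hlt
  set a := P.real A with ha_def
  have ha : 0 < a := ENNReal.toReal_pos hA0 (measure_ne_top _ _)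
  have hfi : Integrable f P := memLp_one_iff_integrable.1
    ⟨hf.aestronglyMeasurable, (hD f _ hf).trans_lt ENNReal.ofReal_lt_top⟩
  have hI : ε < ∫ x in A, |f x| ∂P := by
    rw [eLpNorm_indicator_eq_eLpNorm_restrict hA, eLpNorm_one_eq_lintegral_enorm,
      ← ofReal_integral_norm_eq_lintegral_enorm hfi.integrableOn] at hlt
    exact ((ENNReal.ofReal_lt_ofReal_iff_of_nonneg hε.le).1 hlt)
  -- the average of `|f|` over `A` dominates the indicator of `A`
  classical
  let s : SimpleFunc Ω ℝ := SimpleFunc.piecewise A hA (SimpleFunc.const Ω 1) (SimpleFunc.const Ω 0)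
  have hs : s ⁻¹' {1} = A := by
    ext ω
    by_cases h : ω ∈ A <;> simp [s, h]
  have hmean := hC.normLE_fiberMean hP hoc h1 hf.abs hfm.abs s
  have hAE : E.NormLE (A.indicator 1) (a / ε * (C * M')) := by
    have h2 := hmean.smul (a / ε)
    rw [abs_of_pos (by positivity : 0 < a / ε)] at h2
    refine h2.mono (measurable_one.indicator hA).aestronglyMeasurable (ae_of_all _ fun ω => ?_)
    by_cases h : ω ∈ A
    · have hsω : s ω = 1 := by simp [s, h]
      rw [Set.indicator_of_mem h, Pi.one_apply, abs_one, Pi.smul_apply, fiberMean_apply, hsω, hs,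
        smul_eq_mul]
      refine le_trans ?_ (le_abs_self _)
      have e : a / ε * ((P.real A)⁻¹ * ∫ x in A, |f x| ∂P) = (∫ x in A, |f x| ∂P) / ε := by
        rw [← ha_def]; field_simp
      rw [e, one_le_div hε]
      exact hI.le
    · rw [Set.indicator_of_notMem h, abs_zero]
      exact abs_nonneg _
  have hsmall : ∀ S, MeasurableSet S → P S ≤ P A → E.NormLE (S.indicator 1) (K * a) := by
    intro S hS hSA
    refine (hC.2 _ (S.indicator 1) _ hAE (measurable_one.indicator hA) (measurable_one.indicator hS)
      fun t ht => ?_).weaken (le_of_eq ?_)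
    · have hset : ∀ T : Set Ω, {ω | t < |T.indicator (1 : Ω → ℝ) ω|} = if t < 1 then T else ∅ := by
        intro T
        ext ω
        by_cases h : ω ∈ T <;> by_cases h' : t < 1 <;> simp [h, h', ht]
      rw [hset, hset]
      split_ifs
      · exact hSA
      · exact le_rfl
    · simp only [K]
      field_simp
  have hm : P B ≤ ⌈P.real B / a⌉₊ * P A := by
    rw [← ENNReal.toReal_le_toReal (measure_ne_top _ _)
      (ENNReal.mul_ne_top (ENNReal.natCast_ne_top _) (measure_ne_top _ _)), ENNReal.toReal_mul,
      ENNReal.toReal_natCast]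
    exact (div_le_iff₀ ha).1 (Nat.le_ceil _)
  have hind := hP.induction_on_measure_le (c := P A)
    (p := fun B m => E.NormLE (B.indicator 1) (m * (K * a)))
    (fun B hB h => NormLE.zero.congr (by
      filter_upwards [measure_eq_zero_iff_ae_notMem.1 h] with ω hω using
        (Set.indicator_of_notMem hω _).symm) |>.weaken (by simp))
    (fun B S m hB hS h hBE => by
      refine ((hBE.add (hsmall S hS h)).mono
        (measurable_one.indicator (hB.union hS)).aestronglyMeasurable
        (ae_of_all _ fun ω => ?_)).weaken (le_of_eq (by push_cast; ring))
      by_cases h1 : ω ∈ B <;> by_cases h2 : ω ∈ S <;> simp [h1, h2]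
      norm_num)
    _ B hB hm
  refine hind.weaken ?_
  have h2 : (⌈P.real B / a⌉₊ : ℝ) ≤ P.real B / a + 1 := (Nat.ceil_lt_add_one (by positivity)).le
  have h3 : a ≤ η / K := ENNReal.toReal_le_of_le_ofReal (by positivity) hPA
  rw [le_div_iff₀ hK] at h3
  calc (⌈P.real B / a⌉₊ : ℝ) * (K * a) ≤ (P.real B / a + 1) * (K * a) := by gcongr
    _ = K * P.real B + a * K := by field_simp
    _ ≤ K * P.real B + η := by linarith

/-- In a rearrangement invariant space other than `L¹`, almost sure convergence of a norm bounded
sequence implies convergence for `σ(E, L^∞)`, by Vitali's theorem. -/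
lemma IsTailConstant.tendsto_sigmaLinfty [IsProbabilityMeasure P] (hP : IsNonatomic P)
    (hoc : E.HasOrderContinuousNorm) (hC : E.IsTailConstant C) (h1 : E.NormLE 1 d)
    (hne : (E.carrier : Set (Ω →ₘ[P] ℝ)) ≠ (Lp ℝ 1 P : Set (Ω →ₘ[P] ℝ)))
    {X : ℕ → E.carrier} {Y : E.carrier} (hXY : E.AsTendsto X Y) {M : ℝ}
    (hM : ∀ n, E.nrm (X n) ≤ M) : Tendsto X atTop (@nhds _ E.sigmaLinfty Y) := by
  obtain ⟨D, hD0, hD⟩ := hC.exists_eLpNorm_le hP hoc h1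
  have hmem : ∀ X : E.carrier, MemLp (X : Ω →ₘ[P] ℝ) 1 P := fun X =>
    ⟨X.1.aestronglyMeasurable, (hD _ _ (normLE_coe X)).trans_lt ENNReal.ofReal_lt_top⟩
  have hui : UnifIntegrable (fun n => ((X n : Ω →ₘ[P] ℝ) : Ω → ℝ)) 1 P := by
    intro ε hε
    obtain ⟨δ, hδ, h⟩ := hC.exists_forall_eLpNorm_indicator_le hP hoc h1 hne M hε
    exact ⟨δ, hδ, fun n A hA hPA =>
      h _ ((normLE_coe (X n)).weaken (hM n)) (X n).1.measurable A hA hPA⟩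
  have hL1 := tendsto_Lp_finite_of_tendsto_ae le_rfl ENNReal.one_ne_top
    (fun n => (X n).1.aestronglyMeasurable) (hmem Y) hui hXY
  rw [nhds_iInf, tendsto_iInf]
  intro Z
  rw [nhds_induced, tendsto_comap_iff]
  obtain ⟨k, hk⟩ : ∃ k : ℝ, ∀ᵐ ω ∂P, ‖Z ω‖ ≤ k :=
    ⟨_, ae_le_lpNorm_exponent_top (Lp.memLp Z)⟩
  have hint : ∀ X : E.carrier, Integrable (fun ω => (X : Ω →ₘ[P] ℝ) ω * Z ω) P := fun X =>
    (memLp_one_iff_integrable.1 (hmem X)).mul_bdd (Lp.aestronglyMeasurable Z) hk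
  refine tendsto_integral_of_L1' _ (hint Y).aestronglyMeasurable
    (Eventually.of_forall fun n => hint (X n)) ?_
  have hbound := ENNReal.Tendsto.const_mul (a := ENNReal.ofReal k) hL1
    (Or.inr ENNReal.ofReal_ne_top)
  rw [mul_zero] at hbound
  refine tendsto_of_tendsto_of_tendsto_of_le_of_le tendsto_const_nhds hbound
    (fun n => bot_le) fun n => eLpNorm_le_mul_eLpNorm_of_ae_le_mul ?_ 1
  filter_upwards [hk] with ω hω
  rw [Pi.sub_apply, Pi.sub_apply, ← sub_mul, norm_mul, mul_comm]
  gcongr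

/-- Integration over a measurable set is continuous for `σ(E, L^∞)`. -/
lemma continuous_setIntegral [IsFiniteMeasure P] {A : Set Ω} (hA : MeasurableSet A) :
    Continuous[E.sigmaLinfty, inferInstance]
      fun X : E.carrier => ∫ ω in A, (X : Ω →ₘ[P] ℝ) ω ∂P := by
  let Z : Lp ℝ ∞ P := indicatorConstLp ∞ hA (measure_ne_top P A) (1 : ℝ)
  have h : Continuous[E.sigmaLinfty, inferInstance]
      fun X : E.carrier => ∫ ω, (X : Ω →ₘ[P] ℝ) ω * Z ω ∂P :=
    continuous_iInf_dom (i := Z) continuous_induced_dom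
  convert h using 2 with X
  rw [← integral_indicator hA]
  refine integral_congr_ae ?_
  filter_upwards [indicatorConstLp_coeFn (p := ∞) (hs := hA) (hμs := measure_ne_top P A)
    (c := (1 : ℝ))] with ω hω
  simp only [Z, hω]
  by_cases h : ω ∈ A <;> simp [h]

/-! ### Sublevel sets of functionals with the Fatou property -/

/-- For an order continuous norm, the sublevel sets of a functional with the Fatou property are
closed in norm: a sequence converging fast enough in norm is order convergent. -/
lemma HasFatou.mem_of_norm_approx {ρ : E.carrier → EReal} (hρ : E.HasFatou ρ) {m : ℝ}
    {X : E.carrier} (hX : ∀ ε > 0, ∃ Y : E.carrier, ρ Y ≤ m ∧ E.nrm (Y - X) ≤ ε) : ρ X ≤ m := by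
  choose Y hY hYX using fun n : ℕ => hX ((1 / 2) ^ n) (by positivity)
  obtain ⟨Z, c, hZ, hle⟩ := exists_normLE_sum_abs_le (E := E)
    (u := fun n => (Y n - X : E.carrier).1) fun n => (normLE_coe (Y n - X)).weaken (hYX n)
  have hae : ∀ᵐ ω ∂P, ∀ n, ((Y n - X : E.carrier) : Ω →ₘ[P] ℝ) ω =
      (Y n : Ω →ₘ[P] ℝ) ω - (X : Ω →ₘ[P] ℝ) ω := ae_all_iff.2 fun n => coe_sub_ae_eq (Y n) X
  obtain ⟨W, hW, -⟩ := (normLE_coe X).abs.add hZ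
  have hord : E.OrderTendsto Y X := by
    refine ⟨?_, W, fun n => ?_⟩
    · filter_upwards [hle, hae] with ω h1 h2
      have h3 := (summable_of_sum_range_le (fun _ => abs_nonneg _) h1).tendsto_atTop_zero
      have h4 := (tendsto_zero_iff_abs_tendsto_zero _).2 h3
      simp only [h2] at h4
      simpa using h4.add_const ((X : Ω →ₘ[P] ℝ) ω)
    · rw [← AEEqFun.coeFn_le]
      filter_upwards [AEEqFun.coeFn_abs (Y n : Ω →ₘ[P] ℝ), hle, hae, hW] with ω h1 h2 h3 h4
      rw [h1, h4]
      have h5 := Finset.single_le_sum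
        (f := fun k => |((Y k - X : E.carrier) : Ω →ₘ[P] ℝ) ω|) (fun _ _ => abs_nonneg _)
        (Finset.self_mem_range_succ n)
      have h6 := h5.trans (h2 (n + 1))
      rw [h3 n] at h6
      have h7 := abs_add_le ((Y n : Ω →ₘ[P] ℝ) ω - (X : Ω →ₘ[P] ℝ) ω) ((X : Ω →ₘ[P] ℝ) ω)
      rw [sub_add_cancel] at h7
      simp only [Pi.add_apply]
      linarith
  refine (hρ Y X hord).trans ?_
  exact (liminf_le_liminf (Eventually.of_forall hY)).trans (liminf_const _).le

lemma coe_sum_ae_eq {ι : Type*} (s : Finset ι) (U : ι → E.carrier) :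
    ((∑ i ∈ s, U i : E.carrier) : Ω →ₘ[P] ℝ) =ᵐ[P] fun ω => ∑ i ∈ s, (U i : Ω →ₘ[P] ℝ) ω := by
  classical
  induction s using Finset.induction_on with
  | empty => exact AEEqFun.coeFn_zero
  | insert a s ha ih =>
    rw [Finset.sum_insert ha]
    filter_upwards [AEEqFun.coeFn_add (U a : Ω →ₘ[P] ℝ) (∑ i ∈ s, U i : E.carrier), ih] with ω h1 h2
    rw [Finset.sum_insert ha, ← h2]
    exact h1

/-- The sublevel sets of a quasiconvex and law-invariant functional with the Fatou property contain
the conditional expectations of their members on finite partitions, since they contain all averages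
of copies. -/
lemma HasFatou.le_of_ae_eq_fiberMean [IsProbabilityMeasure P] (hP : IsNonatomic P)
    (hoc : E.HasOrderContinuousNorm) (hC : E.IsTailConstant C) (h1 : E.NormLE 1 d)
    {ρ : E.carrier → EReal} (hρ : E.HasFatou ρ) (hqc : E.IsQuasiconvex ρ)
    (hlaw : E.IsLawInvariant ρ) {m : ℝ} {X V : E.carrier} (hX : ρ X ≤ m) {s : SimpleFunc Ω ℝ}
    (hV : (V : Ω →ₘ[P] ℝ) =ᵐ[P] fiberMean P s (X : Ω →ₘ[P] ℝ)) : ρ V ≤ m := by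
  refine hρ.mem_of_norm_approx fun ε hε => ?_
  have hXm : Measurable (X : Ω →ₘ[P] ℝ) := X.1.measurable
  obtain ⟨Y, n, hn0, hYm, hYi, hY⟩ := hC.exists_average_normLE hP hoc h1 (normLE_coe X) hXm s hε
  choose U hU _ using fun i => hC.normLE_of_identDistrib (normLE_coe X) hXm (hYm i) (hYi i)
  have hUm : ∀ i, ρ (U i) ≤ m := by
    intro i
    rw [hlaw (U i) X ((IdentDistrib.of_ae_eq (U i).1.measurable.aemeasurable (hU i)).trans (hYi i))]
    exact hX
  let A : E.carrier := ∑ i ∈ Finset.range n, (n : ℝ)⁻¹ • U i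
  have hA : ρ A ≤ m := by
    refine (hqc m).sum_mem (fun _ _ => by positivity) ?_ fun i _ => hUm i
    rw [Finset.sum_const, Finset.card_range, nsmul_eq_mul, mul_inv_cancel₀ (Nat.cast_ne_zero.2 hn0)]
  have hAae : (A : Ω →ₘ[P] ℝ) =ᵐ[P] fun ω => (∑ i ∈ Finset.range n, Y i ω) / n := by
    filter_upwards [coe_sum_ae_eq (Finset.range n) fun i => (n : ℝ)⁻¹ • U i, ae_all_iff.2 hU,
      ae_all_iff.2 fun i => AEEqFun.coeFn_smul (n : ℝ)⁻¹ (U i : Ω →ₘ[P] ℝ)] with ω h2 h3 h4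
    rw [h2, Finset.sum_div]
    refine Finset.sum_congr rfl fun i _ => ?_
    rw [Submodule.coe_smul, h4, Pi.smul_apply, h3, smul_eq_mul, div_eq_inv_mul]
  refine ⟨A, hA, normLE_coe_iff.1 (hY.congr ?_)⟩
  filter_upwards [coe_sub_ae_eq A V, hAae, hV] with ω h2 h3 h4
  rw [h2, Pi.sub_apply, h3, h4]

end BanachFunctionSpace

theorem proposition2p8 {Ω : Type*} [MeasurableSpace Ω] (P : Measure Ω) [IsProbabilityMeasure P]
    (hP : IsNonatomic P) (E : BanachFunctionSpace P) (hri : E.IsRearrangementInvariant)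
    (hoc : E.HasOrderContinuousNorm)
    (hne : (E.carrier : Set (Ω →ₘ[P] ℝ)) ≠ (Lp ℝ 1 P : Set (Ω →ₘ[P] ℝ)))
    (ρ : E.carrier → EReal) (hbot : E.NeverBot ρ) (hproper : E.IsProper ρ)
    (hqc : E.IsQuasiconvex ρ) (hlaw : E.IsLawInvariant ρ) :
    [E.HasStrongFatou ρ, E.IsSigmaLinftyLsc ρ, E.HasFatou ρ].TFAE := by
  obtain ⟨d, h1⟩ := hri.exists_normLE_one hP
  obtain ⟨C, hC⟩ := hri.exists_isTailConstant hP hoc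
  tfae_have 1 → 3 := by
    rintro h X Y ⟨hXY, Z, hZ⟩
    exact h X Y hXY ⟨E.nrm Z, fun n => E.nrm_mono _ _ ((hZ n).trans (le_abs_self _))⟩
  tfae_have 2 → 1 := by
    rintro h X Y hXY ⟨M, hM⟩
    refine EReal.le_of_forall_lt_iff_le.1 fun z hz => ?_
    have hlim := hC.tendsto_sigmaLinfty hP hoc h1 hne hXY hM
    let _ : TopologicalSpace E.carrier := E.sigmaLinfty
    exact (h z).mem_of_frequently_of_tendsto
      ((frequently_lt_of_liminf_lt (by isBoundedDefault) hz).mono fun n hn => hn.le) hlim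
  tfae_have 3 → 2 := by
    intro h m
    let _ : TopologicalSpace E.carrier := E.sigmaLinfty
    refine isClosed_of_closure_subset fun X hX => ?_
    have hXm : Measurable (X : Ω →ₘ[P] ℝ) := X.1.measurable
    obtain ⟨D, hD0, hD⟩ := hC.exists_eLpNorm_le hP hoc h1
    have hint : ∀ X : E.carrier, Integrable (X : Ω →ₘ[P] ℝ) P := fun X =>
      memLp_one_iff_integrable.1
        ⟨X.1.aestronglyMeasurable, (hD _ _ (BanachFunctionSpace.normLE_coe X)).trans_lt
          ENNReal.ofReal_lt_top⟩
    have hfib : ∀ (s : SimpleFunc Ω ℝ) (V : E.carrier),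
        (V : Ω →ₘ[P] ℝ) =ᵐ[P] fiberMean P s (X : Ω →ₘ[P] ℝ) → ρ V ≤ m := by
      intro s V hV
      refine h.mem_of_norm_approx fun ε hε => ?_
      obtain ⟨R, hR0, hR⟩ := exists_abs_fiberMean_le P s
      have hd0 := h1.nonneg
      let δ := ε / (R * (d + 1))
      have hδ : 0 < δ := by positivity
      -- members of the sublevel set whose integrals over the fibres are close to those of `X`
      have hnear : ∀ᶠ Y : E.carrier in 𝓝 X, ∀ y ∈ s.range,
          |(∫ ω in s ⁻¹' {y}, (Y : Ω →ₘ[P] ℝ) ω ∂P) - ∫ ω in s ⁻¹' {y}, (X : Ω →ₘ[P] ℝ) ω ∂P|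
            < δ := by
        refine (Finset.eventually_all s.range).2 fun y _ => ?_
        have hcont : Continuous fun X : E.carrier => ∫ ω in s ⁻¹' {y}, (X : Ω →ₘ[P] ℝ) ω ∂P :=
          BanachFunctionSpace.continuous_setIntegral (s.measurableSet_fiber y)
        exact hcont.continuousAt.eventually (Metric.ball_mem_nhds _ hδ)
      obtain ⟨Y, hYm, hY⟩ := ((mem_closure_iff_frequently.1 hX).and_eventually hnear).exists
      obtain ⟨W, hW, -⟩ := hC.normLE_fiberMean hP hoc h1 (BanachFunctionSpace.normLE_coe Y)
        Y.1.measurable s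
      refine ⟨W, h.le_of_ae_eq_fiberMean hP hoc hC h1 hqc hlaw hYm hW, ?_⟩
      have hsub := fiberMean_sub s (hint Y) (hint X)
      have hle : ∀ ω, |fiberMean P s (((Y : Ω →ₘ[P] ℝ) : Ω → ℝ) - ((X : Ω →ₘ[P] ℝ) : Ω → ℝ)) ω| ≤
          R * δ := by
        refine hR _ _ fun y hy => ?_
        simp only [Pi.sub_apply]
        rw [integral_sub (hint Y).integrableOn (hint X).integrableOn]
        exact (hY y hy).le
      have hE := h1.of_abs_le (measurable_fiberMean P s _).aestronglyMeasurable
        (by positivity) (ae_of_all _ hle)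
      refine (BanachFunctionSpace.normLE_coe_iff.1 (hE.congr ?_)).trans ?_
      · filter_upwards [BanachFunctionSpace.coe_sub_ae_eq W V, hW, hV] with ω h2 h3 h4
        rw [h2, hsub, Pi.sub_apply, Pi.sub_apply, h3, h4]
      · have e : R * δ * d = ε * (d / (d + 1)) := by
          simp only [δ]; field_simp
        rw [e]
        exact mul_le_of_le_one_right hε.le ((div_le_one (by positivity)).2 (by linarith))
    refine h.mem_of_norm_approx fun ε hε => ?_
    obtain ⟨s, hs⟩ := hC.exists_normLE_fiberMean_sub hP hoc h1
      (BanachFunctionSpace.normLE_coe X) hXm hε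
    obtain ⟨V, hV, -⟩ := hC.normLE_fiberMean hP hoc h1 (BanachFunctionSpace.normLE_coe X) hXm s
    refine ⟨V, hfib s V hV, BanachFunctionSpace.normLE_coe_iff.1 (hs.congr ?_)⟩
    filter_upwards [BanachFunctionSpace.coe_sub_ae_eq V X, hV] with ω h2 h3
    rw [h2, Pi.sub_apply, Pi.sub_apply, h3]
  tfae_finish
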